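/- **Setting.** A non-interactive quantum state commitment (QSC) consists, for every security parameter $\lambda$, of a unitary $\mathsf{Com}$ on $n(\lambda)+\lambda$ qubits, viewed on the input side as an $n$-qubit message register $\mathsf M$ and a $\lambda$-qubit register $\mathsf W$, and on the output side divided into a commitment register $\mathsf C$ and a decommitment register $\mathsf D$. Write $\widehat{X}=\mathsf{Com}\,X\,\mathsf{Com}^\dagger$ and $\Pi=\mathsf{Com}\,(I_{\mathsf M}\otimes|0\rangle\langle 0|_{\mathsf W})\,\mathsf{Com}^\dagger$. **Swap binding.** In the swap binding experiment with challenge bit $b$, an adversary with internal register $\mathsf R$ sends $(\mathsf C,\mathsf D)$ to the challenger. The challenger applies $\mathsf{Com}^\dagger$ and measures whether $\mathsf W$ is $|0^\lambda\rangle$; if not, the experiment aborts and outputs a uniformly random bit. Otherwise, if $b=1$, the challenger applies $\mathsf{SWAP}[\mathsf M,\mathsf M']$ with a fresh $n$-qubit register $\mathsf M'=|0^n\rangle$ (if $b=0$ it does nothing); then it applies $\mathsf{Com}$ and returns $\mathsf D$. The adversary outputs a bit $b'$ (a function of $\mathsf D,\mathsf R$ only), which is the output of the experiment. The adversary wins if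 $b'=b$, for uniformly random $b$. **Oracle swap binding.** The adversary also chooses a unitary $\mathcal O$ on $(\mathsf M,\mathsf R)$. After getting $\mathsf D$ back, it may repeatedly apply to $(\mathsf C,\mathsf D,\mathsf R,\mathsf M')$, by sending $(\mathsf R,\mathsf D)$ to an oracle, the unitary $$G_b=\big(\widehat{\mathsf{SWAP}[\mathsf M,\mathsf M']}\big)^b\,\widehat{\mathcal O}\,\big(\widehat{\mathsf{SWAP}[\mathsf M,\mathsf M']}\big)^b\,\Pi+(I-\Pi),$$ interleaved with its own unitaries on $(\mathsf D,\mathsf R)$. **Adversary classes.** *Computational*: non-uniform quantum polynomial time, i.e. for every $\lambda$ an arbitrary initial state of $(\mathsf C,\mathsf D,\mathsf R)$ (advice and ancillas) and circuits of polynomially many arbitrary one- and two-qubit gates, with polynomially many qubits in $\mathsf R$; in the oracle experiment each oracle query has unit cost and $\mathcal O$ must have a polynomial-size circuit as well. *Statistical*: arbitrary initial states and unitaries with no bound on size (and an arbitrary unitary $\mathcal O$), the number of oracle queries being polynomial in $\lambda$. A QSC is computationally (resp. statistically) swap binding, resp. oracle swap binding, if there is a negligible function $\mu:\mathbb N\to[0,1]$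 such that every adversary of the respective class wins the respective experiment with probability at most $\tfrac12+\mu(\lambda)$, for all sufficiently large $\lambda$ (where "sufficiently large" may depend on the adversary; in the statistical swap binding experiment, for all $\lambda$). **Theorem.** For every non-interactive QSC: if it is computationally swap binding, then it is computationally oracle swap binding; and if it is statistically swap binding, then it is statistically oracle swap binding. -/

import Mathlib

open Filter
open scoped ComplexOrder

noncomputable section

/-! ## Qubits, operators and circuits -/

/-- Operators on the Hilbert space of a family of qubits labelled by `ι`; the computational basis
is indexed by the bit strings `ι → Bool`, and `false` is the bit `0`. -/
abbrev QOp (ι : Type) : Type := Matrix (ι → Bool) (ι → Bool) ℂ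

/-- Unitary operators on the qubits labelled by `ι`. -/
abbrev QUnitary (ι : Type) [Fintype ι] [DecidableEq ι] : Submonoid (QOp ι) :=
  Matrix.unitaryGroup (ι → Bool) ℂ

/-- Density matrices: positive semidefinite of trace one. -/
def IsDensity {ι : Type} [Fintype ι] [DecidableEq ι] (ρ : QOp ι) : Prop :=
  ρ.PosSemidef ∧ ρ.trace = 1

open Classical in
/-- The operator that acts as `A` on the qubits `e k`, `k : κ`, and as the identity on all the
other qubits of `ι`. -/
def onQubits {κ ι : Type} (e : κ ↪ ι) (A : QOp κ) : QOp ι :=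
  Matrix.of fun x y =>
    if ∀ i, i ∉ Set.range e → x i = y i then A (fun k => x (e k)) (fun k => y (e k)) else 0

/-- Tensor product of two operators on disjoint families of qubits. -/
def tensorOp {ι κ : Type} (A : QOp ι) (B : QOp κ) : QOp (ι ⊕ κ) :=
  Matrix.of fun x y =>
    A (fun i => x (Sum.inl i)) (fun i => y (Sum.inl i)) *
      B (fun k => x (Sum.inr k)) (fun k => y (Sum.inr k))

/-- The projector `|0…0⟩⟨0…0|` on all qubits of `ι`; it is also the all-zero state. -/
def zeroProj (ι : Type) [Fintype ι] [DecidableEq ι] : QOp ι :=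
  Matrix.diagonal fun x => if x = (fun _ => false) then 1 else 0

/-- The projector `|b⟩⟨b|` on the qubit `i`. -/
def bitProj {ι : Type} [Fintype ι] [DecidableEq ι] (i : ι) (b : Bool) : QOp ι :=
  Matrix.diagonal fun x => if x i = b then 1 else 0

/-- The unitary exchanging two registers of `n` qubits, `|x⟩|y⟩ ↦ |y⟩|x⟩`. -/
def swapOp (n : ℕ) : QOp (Fin n ⊕ Fin n) :=
  Matrix.of fun x y => if x = y ∘ Sum.swap then 1 else 0

/-- An elementary gate: an arbitrary unitary on at most two of the qubits. -/
def IsGate {ι : Type} (U : QOp ι) : Prop :=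
  ∃ (k : ℕ) (e : Fin k ↪ ι) (V : QUnitary (Fin k)), k ≤ 2 ∧ U = onQubits e V

/-- `U` is implemented by a quantum circuit consisting of at most `T` elementary gates. -/
def HasCircuit {ι : Type} [Fintype ι] [DecidableEq ι] (T : ℕ) (U : QOp ι) : Prop :=
  ∃ L : List (QOp ι), L.length ≤ T ∧ (∀ g ∈ L, IsGate g) ∧ L.prod = U

/-- A function `ℕ → [0,1]` is negligible if it decreases faster than any inverse polynomial. -/
def Negligible (μ : ℕ → ℝ) : Prop :=
  (∀ κ, 0 ≤ μ κ ∧ μ κ ≤ 1) ∧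
    Asymptotics.SuperpolynomialDecay atTop (fun κ : ℕ => (κ : ℝ)) μ

/-! ## Quantum state commitments -/

/-- A non-interactive quantum state commitment: for every security parameter `κ` a unitary `Com` on
an `n κ`-qubit message register `M` and a `κ`-qubit register `W`, together with the division of
these `n κ + κ` qubits, after `Com` has been applied, into the commitment register `C` (the qubits
in `commitReg κ`) and the decommitment register `D` (all other qubits). -/
structure QSC where
  n : ℕ → ℕ
  Com : ∀ κ : ℕ, QUnitary (Fin (n κ) ⊕ Fin κ)
  commitReg : ∀ κ : ℕ, Finset (Fin (n κ) ⊕ Fin κ)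

namespace QSC

variable (S : QSC) (κ : ℕ)

/-- The qubits of `(M, W)`, which are also the qubits of `(C, D)`. -/
abbrev MW : Type := Fin (S.n κ) ⊕ Fin κ

/-- The qubits of the decommitment register `D`. -/
abbrev DReg : Type := {q : S.MW κ // q ∉ S.commitReg κ}

/-- All the qubits of the experiment with an adversary who has an internal register `R` of `r`
qubits: those of `(C, D)`, those of `R`, and the `n κ` qubits of the challenger's register `M'`. -/
abbrev Total (r : ℕ) : Type := (S.MW κ ⊕ Fin r) ⊕ Fin (S.n κ)

variable {κ} (r : ℕ)

/-- `(M, W)`, that is `(C, D)`, inside the whole system. -/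
def embMW : S.MW κ ↪ S.Total κ r :=
  ⟨fun q => Sum.inl (Sum.inl q), fun _ _ h => Sum.inl_injective (Sum.inl_injective h)⟩

/-- `W` inside the whole system. -/
def embW : Fin κ ↪ S.Total κ r :=
  ⟨fun j => Sum.inl (Sum.inl (Sum.inr j)),
    fun _ _ h => Sum.inr_injective (Sum.inl_injective (Sum.inl_injective h))⟩

/-- `(M, M')` inside the whole system. -/
def embSwap : Fin (S.n κ) ⊕ Fin (S.n κ) ↪ S.Total κ r :=
  ⟨Sum.elim (fun i => Sum.inl (Sum.inl (Sum.inl i))) Sum.inr, by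
    rintro (i | i) (j | j) h <;> simp_all⟩

/-- `(M, R)` inside the whole system. -/
def embMR : Fin (S.n κ) ⊕ Fin r ↪ S.Total κ r :=
  ⟨Sum.elim (fun i => Sum.inl (Sum.inl (Sum.inl i))) (fun j => Sum.inl (Sum.inr j)), by
    rintro (i | i) (j | j) h <;> simp_all⟩

/-- `(D, R)` inside the whole system. -/
def embDR : S.DReg κ ⊕ Fin r ↪ S.Total κ r :=
  ⟨Sum.elim (fun q => Sum.inl (Sum.inl q.1)) (fun j => Sum.inl (Sum.inr j)), by
    rintro (i | i) (j | j) h <;> simp_all [Subtype.ext_iff]⟩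

/-- `Com` on the whole system. -/
def comT : QOp (S.Total κ r) := onQubits (S.embMW r) (S.Com κ).1

/-- `|0⟩⟨0|` on `W`, on the whole system. -/
def zeroW : QOp (S.Total κ r) := onQubits (S.embW r) (zeroProj (Fin κ))

/-- `SWAP[M, M']` on the whole system. -/
def swapMM : QOp (S.Total κ r) := onQubits (S.embSwap r) (swapOp (S.n κ))

/-- `Com · A · Com†`. -/
def hat (A : QOp (S.Total κ r)) : QOp (S.Total κ r) :=
  S.comT r * A * (S.comT r).conjTranspose

/-- The projection onto valid commitment-decommitment pairs. -/
def validProj : QOp (S.Total κ r) := S.hat r (S.zeroW r)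

/-- The state of the whole system (subnormalized: its trace is the probability of no abort) after
the challenger has received `(C, D)`, in the joint state `ρ` with `R`, has applied `Com†`, has found
`W` to be zero, has applied `SWAP[M, M']` if `b = 1` to `M` and the fresh zero register `M'`,
and has applied `Com`. -/
def challengeState (b : Bool) (ρ : QOp (S.MW κ ⊕ Fin r)) : QOp (S.Total κ r) :=
  let ρ₁ := (S.comT r).conjTranspose * tensorOp ρ (zeroProj (Fin (S.n κ))) * S.comT r
  let ρ₂ := S.zeroW r * ρ₁ * S.zeroW r
  let ρ₃ := S.swapMM r ^ b.toNat * ρ₂ * (S.swapMM r ^ b.toNat).conjTranspose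
  S.comT r * ρ₃ * (S.comT r).conjTranspose

/-- The probability that the experiment with challenge bit `b` outputs `b'`, when the adversary
holds `R` and sends `(C, D)` in the joint state `ρ`, then runs `V`, and returns the result of
measuring the qubit `out` of `R`. If the challenger aborts, the output is a random bit. -/
def outputProb (b b' : Bool) (ρ : QOp (S.MW κ ⊕ Fin r)) (V : QOp (S.Total κ r)) (out : Fin r) :
    ℝ :=
  (1 - (S.challengeState r b ρ).trace.re) / 2 +
    (bitProj (Sum.inl (Sum.inr out)) b' *
      (V * S.challengeState r b ρ * V.conjTranspose)).trace.re

variable (κ)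

/-! ## Swap binding -/

/-- An adversary at security parameter `κ`. It holds `(C, D)` and a register `R` of `r` qubits,
which start in the state `init` (its advice and its ancillas); it applies `prep` and sends
`(C, D)`. When it gets `D` back, it applies `guess` to `(D, R)` and measures the qubit `out`. -/
structure Adversary where
  r : ℕ
  init : QOp (S.MW κ ⊕ Fin r)
  init_density : IsDensity init
  prep : QUnitary (S.MW κ ⊕ Fin r)
  guess : QUnitary (S.DReg κ ⊕ Fin r)
  out : Fin r

variable {S κ}

/-- The joint state of `(C, D)` and `R` when `(C, D)` is sent. -/
def Adversary.sent (A : Adversary S κ) : QOp (S.MW κ ⊕ Fin A.r) :=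
  A.prep.1 * A.init * A.prep.1.conjTranspose

/-- The probability, over a uniformly random bit `b`, that the swap binding experiment with
challenge bit `b` outputs `b`. -/
def Adversary.winProb (A : Adversary S κ) : ℝ :=
  (∑ b : Bool, S.outputProb A.r b b A.sent (onQubits (S.embDR A.r) A.guess.1) A.out) / 2

/-- The adversary has size at most `T`: number of qubits of `R`, and circuit sizes. -/
def Adversary.SizeLE (A : Adversary S κ) (T : ℕ) : Prop :=
  A.r ≤ T ∧ HasCircuit T A.prep.1 ∧ HasCircuit T A.guess.1

variable (S)

/-- Computational swap binding: one negligible function bounds the advantage of every non-uniform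
polynomial-size adversary (asymptotically). -/
def CompSwapBinding : Prop :=
  ∃ μ : ℕ → ℝ, Negligible μ ∧
    ∀ A : ∀ κ, Adversary S κ,
      (∃ p : Polynomial ℕ, ∀ κ, (A κ).SizeLE (p.eval κ)) →
      ∀ᶠ κ in atTop, (A κ).winProb ≤ 1 / 2 + μ κ

/-- Statistical swap binding: the same for adversaries of unbounded size. -/
def StatSwapBinding : Prop :=
  ∃ μ : ℕ → ℝ, Negligible μ ∧
    ∀ (A : ∀ κ, Adversary S κ) (κ : ℕ), (A κ).winProb ≤ 1 / 2 + μ κ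

/-! ## Oracle swap binding -/

variable (κ)

/-- An adversary in the oracle swap binding experiment. It chooses a unitary `O` on `(M, R)`. After
getting `D` back it applies `guess` to `(D, R)` and then, for each `U` in the list `rest`, queries
the oracle on `(D, R)` and applies `U` to `(D, R)`; finally it measures the qubit `out` of `R`. The
number of oracle queries is the length of `rest`. -/
structure OracleAdversary extends Adversary S κ where
  O : QUnitary (Fin (S.n κ) ⊕ Fin r)
  rest : List (QUnitary (S.DReg κ ⊕ Fin r))

variable {S κ}

/-- The oracle `G_b = (SWAP^)^b · O^ · (SWAP^)^b · Π + (1 - Π)`, where `X^ = Com · X · Com†` and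
`Π` is the projection onto valid commitment-decommitment pairs. -/
def OracleAdversary.oracle (A : OracleAdversary S κ) (b : Bool) : QOp (S.Total κ A.r) :=
  S.hat A.r (S.swapMM A.r) ^ b.toNat * S.hat A.r (onQubits (S.embMR A.r) A.O.1) *
      S.hat A.r (S.swapMM A.r) ^ b.toNat * S.validProj A.r +
    (1 - S.validProj A.r)

/-- The second phase of the adversary, with its queries answered by `G_b`. -/
def OracleAdversary.run (A : OracleAdversary S κ) (b : Bool) : QOp (S.Total κ A.r) :=
  A.rest.foldl (fun V U => onQubits (S.embDR A.r) U.1 * A.oracle b * V)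
    (onQubits (S.embDR A.r) A.guess.1)

/-- The probability, over a uniformly random bit `b`, that the experiment with challenge bit `b`
and oracle `G_b` outputs `b`. -/
def OracleAdversary.oracleWinProb (A : OracleAdversary S κ) : ℝ :=
  (∑ b : Bool, S.outputProb A.r b b A.sent (A.run b) A.out) / 2

/-- The adversary, the unitary `O` included, has size at most `T`: number of qubits of `R`, number
of queries, and size of each of the circuits. -/
def OracleAdversary.OracleSizeLE (A : OracleAdversary S κ) (T : ℕ) : Prop :=
  A.toAdversary.SizeLE T ∧ A.rest.length ≤ T ∧ (∀ U ∈ A.rest, HasCircuit T U.1) ∧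
    HasCircuit T A.O.1

variable (S)

/-- Computational oracle swap binding. -/
def CompOracleSwapBinding : Prop :=
  ∃ μ : ℕ → ℝ, Negligible μ ∧
    ∀ A : ∀ κ, OracleAdversary S κ,
      (∃ p : Polynomial ℕ, ∀ κ, (A κ).OracleSizeLE (p.eval κ)) →
      ∀ᶠ κ in atTop, (A κ).oracleWinProb ≤ 1 / 2 + μ κ

/-- Statistical oracle swap binding: computationally unbounded adversaries (with an arbitrary
unitary `O`) that make polynomially many oracle queries. -/
def StatOracleSwapBinding : Prop :=
  ∃ μ : ℕ → ℝ, Negligible μ ∧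
    ∀ A : ∀ κ, OracleAdversary S κ,
      (∃ p : Polynomial ℕ, ∀ κ, (A κ).rest.length ≤ p.eval κ) →
      ∀ᶠ κ in atTop, (A κ).oracleWinProb ≤ 1 / 2 + μ κ

end QSC

end

/-! Write `P` for the projection onto valid pairs (C, D), `z` for |0⟩⟨0| on M', `p = P z`, and `s`
for the swap conjugated by Com. Then `s` is a self-adjoint unitary commuting with `P`, and the
challenger applies `p` (b = 0) or `s p` (b = 1). Since an abort yields a fair coin, an adversary
with final unitary V and output observable Z wins with probability 1/2 plus a quarter of the
expectation of p (V†ZV − s V†ZV s) p. The argument turns this into a statement about operators and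
then follows the oracle queries.

Hadamard test (`norm_startProj_conj_le`). If every Hadamard test of a unitary U on (D, R), on every
initial state, has advantage at most ε, then p (U − s U s) p has norm at most 4ε. The initial state
of an adversary is arbitrary, so bounds on expectations are bounds on norms.

Compression (`norm_compression_le`). The left `p` may be weakened to `P`, so that M' is no longer
required to be zero there, at the cost of a factor 2. The part of the operator that leaves `z` comes
from an operator on (C, D, R) alone, whose norm is already visible on M' = 0.

Histories (`IsHistory.query`, `IsHistory.norm_conj_sub_le`). For b = 0 the evolution on `p` is a sum
of terms W k, where W is a product of the adversary's own unitaries and k lies in the range of `p`: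
a query adds the single term k = (O − 1) P x, with O the conjugated oracle unitary. For b = 1 the
evolution stays close to the sum of the terms W s k with the same k, because the compression bound
moves `s` past each W up to a small error. The final expectations then differ by terms k†(V†ZW − s
V†ZW s)k', which are small by the Hadamard test of V†ZW.

All errors are polynomial in the number q of queries, giving advantage at most 280 (q+1)⁴ ε
(`oracleWinProb_le`). In the computational case the tested unitaries must have polynomial circuits,
so controlled circuits are compiled into gates. The negligible bound for the oracle game is √μ,
which eventually dominates every polynomial multiple of μ. -/

set_option linter.unusedSectionVars false

noncomputable section

open scoped Matrix.Norms.L2Operator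

/-! ### Operators acting on a subset of the qubits -/

section OnQubits

variable {ι κ μ : Type}

theorem eq_extend_iff (e : κ ↪ ι) (x z : ι → Bool) (a : κ → Bool) :
    z = Function.extend e a x ↔ (∀ i, i ∉ Set.range e → x i = z i) ∧ (fun k => z (e k)) = a := by
  classical
  constructor
  · rintro rfl
    refine ⟨fun i hi => ?_, funext fun k => e.injective.extend_apply _ _ _⟩
    rw [Function.extend_apply' _ _ _ hi]
  · rintro ⟨h, rfl⟩
    funext i
    by_cases hi : i ∈ Set.range e
    · obtain ⟨k, rfl⟩ := hi
      rw [e.injective.extend_apply]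
    · rw [Function.extend_apply' _ _ _ hi, h i hi]

variable [Fintype ι] [DecidableEq ι] [Fintype κ] [DecidableEq κ] [Fintype μ] [DecidableEq μ]

/-- Row `x` of `onQubits e A` is supported on the strings that agree with `x` off the range of `e`;
these are parametrized by their restriction `a` to that range. -/
theorem onQubits_mul_apply (e : κ ↪ ι) (A : QOp κ) (M : QOp ι) (x y : ι → Bool) :
    (onQubits e A * M) x y =
      ∑ a, A (fun k => x (e k)) a * M (Function.extend e a x) y := by
  classical
  rw [Matrix.mul_apply]
  have hinj : Function.Injective fun a : κ → Bool => Function.extend e a x :=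
    Function.extend_injective e.injective x
  rw [← Finset.sum_subset (Finset.subset_univ
    (Finset.univ.image fun a : κ → Bool => Function.extend e a x)),
    Finset.sum_image hinj.injOn]
  · refine Finset.sum_congr rfl fun a _ => ?_
    obtain ⟨h1, h2⟩ := (eq_extend_iff e x _ a).1 rfl
    simp only [onQubits, Matrix.of_apply]
    rw [if_pos h1, h2]
  · intro z _ hz
    simp only [onQubits, Matrix.of_apply]
    rw [if_neg, zero_mul]
    intro h
    exact hz (Finset.mem_image.2 ⟨_, Finset.mem_univ _, ((eq_extend_iff e x z _).2 ⟨h, rfl⟩).symm⟩)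

theorem onQubits_apply_of_agree (e : κ ↪ ι) (A : QOp κ) {x y : ι → Bool}
    (h : ∀ i, i ∉ Set.range e → x i = y i) :
    onQubits e A x y = A (fun k => x (e k)) (fun k => y (e k)) := by
  simp only [onQubits, Matrix.of_apply]
  exact if_pos h

theorem onQubits_apply_of_not (e : κ ↪ ι) (A : QOp κ) {x y : ι → Bool}
    (h : ¬ ∀ i, i ∉ Set.range e → x i = y i) : onQubits e A x y = 0 := by
  simp only [onQubits, Matrix.of_apply]
  exact if_neg h

theorem onQubits_mul (e : κ ↪ ι) (A B : QOp κ) :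
    onQubits e (A * B) = onQubits e A * onQubits e B := by
  classical
  ext x y
  rw [onQubits_mul_apply]
  have key : ∀ a : κ → Bool, (∀ i, i ∉ Set.range e → Function.extend e a x i = y i) ↔
      ∀ i, i ∉ Set.range e → x i = y i := fun a =>
    forall₂_congr fun i hi => by rw [Function.extend_apply' _ _ _ hi]
  have hext : ∀ a : κ → Bool, (fun k => Function.extend e a x (e k)) = a := fun a =>
    funext fun k => e.injective.extend_apply _ _ _
  by_cases h : ∀ i, i ∉ Set.range e → x i = y i
  · rw [onQubits_apply_of_agree e _ h, Matrix.mul_apply]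
    refine Finset.sum_congr rfl fun a _ => ?_
    rw [onQubits_apply_of_agree e _ ((key a).2 h), hext]
  · rw [onQubits_apply_of_not e _ h]
    refine (Finset.sum_eq_zero fun a _ => ?_).symm
    rw [onQubits_apply_of_not e _ (mt (key a).1 h), mul_zero]

/-- Only one intermediate string survives: it takes the values of `y` on the range of `e` and those
of `x` elsewhere. The resulting formula is symmetric in the two factors, which yields
`onQubits_commute`. -/
theorem onQubits_mul_of_disjoint_apply (e : κ ↪ ι) (f : μ ↪ ι)
    (hd : Disjoint (Set.range e) (Set.range f)) (A : QOp κ) (B : QOp μ) (x y : ι → Bool)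
    [Decidable (∀ i, i ∉ Set.range e → i ∉ Set.range f → x i = y i)] :
    (onQubits e A * onQubits f B) x y =
      if ∀ i, i ∉ Set.range e → i ∉ Set.range f → x i = y i then
        A (fun k => x (e k)) (fun k => y (e k)) * B (fun k => x (f k)) (fun k => y (f k))
      else 0 := by
  classical
  rw [onQubits_mul_apply]
  have hf : ∀ (a : κ → Bool), (fun k => Function.extend e a x (f k)) = fun k => x (f k) := by
    intro a
    funext k
    rw [Function.extend_apply']
    intro h
    exact Set.disjoint_left.1 hd h ⟨k, rfl⟩
  rw [Finset.sum_eq_single fun k => y (e k)]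
  · split_ifs with h
    · rw [onQubits_apply_of_agree, hf]
      intro i hi
      by_cases hie : i ∈ Set.range e
      · obtain ⟨k, rfl⟩ := hie
        rw [e.injective.extend_apply]
      · rw [Function.extend_apply' _ _ _ hie, h i hie hi]
    · rw [onQubits_apply_of_not, mul_zero]
      intro h'
      apply h
      intro i hi hi'
      rw [← h' i hi', Function.extend_apply' _ _ _ hi]
  · intro a _ ha
    rw [onQubits_apply_of_not, mul_zero]
    intro h'
    apply ha
    funext k
    rw [← h' (e k) (Set.disjoint_left.1 hd ⟨k, rfl⟩), e.injective.extend_apply]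
  · simp

theorem onQubits_commute (e : κ ↪ ι) (f : μ ↪ ι)
    (hd : Disjoint (Set.range e) (Set.range f)) (A : QOp κ) (B : QOp μ) :
    Commute (onQubits e A) (onQubits f B) := by
  classical
  ext x y
  rw [onQubits_mul_of_disjoint_apply e f hd, onQubits_mul_of_disjoint_apply f e hd.symm]
  simp only [mul_comm]
  congr 1
  exact propext ⟨fun h i a b => h i b a, fun h i a b => h i b a⟩

theorem onQubits_add (e : κ ↪ ι) (A B : QOp κ) :
    onQubits e (A + B) = onQubits e A + onQubits e B := by
  ext x y
  simp only [onQubits, Matrix.of_apply, Matrix.add_apply]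
  split_ifs <;> simp

theorem onQubits_smul (e : κ ↪ ι) (c : ℂ) (A : QOp κ) :
    onQubits e (c • A) = c • onQubits e A := by
  ext x y
  simp only [onQubits, Matrix.of_apply, Matrix.smul_apply]
  split_ifs <;> simp

theorem onQubits_conjTranspose (e : κ ↪ ι) (A : QOp κ) :
    onQubits e A.conjTranspose = (onQubits e A).conjTranspose := by
  ext x y
  simp only [onQubits, Matrix.of_apply, Matrix.conjTranspose_apply]
  simp only [eq_comm (a := x _)]
  split_ifs <;> simp

theorem onQubits_diagonal (e : κ ↪ ι) (d : (κ → Bool) → ℂ) :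
    onQubits e (Matrix.diagonal d) = Matrix.diagonal fun x : ι → Bool => d fun k => x (e k) := by
  ext x y
  simp only [onQubits, Matrix.of_apply, Matrix.diagonal_apply]
  by_cases h : x = y
  · subst h; simp
  · rw [if_neg h]
    split_ifs with h1 h2
    · exfalso
      apply h
      funext i
      by_cases hi : i ∈ Set.range e
      · obtain ⟨k, rfl⟩ := hi
        exact congrFun h2 k
      · exact h1 i hi
    · rfl
    · rfl

theorem onQubits_one (e : κ ↪ ι) : onQubits e (1 : QOp κ) = 1 := by
  rw [← Matrix.diagonal_one, onQubits_diagonal, ← Matrix.diagonal_one]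

theorem onQubits_trans (e : κ ↪ μ) (f : μ ↪ ι) (A : QOp κ) :
    onQubits (e.trans f) A = onQubits f (onQubits e A) := by
  classical
  ext x y
  simp only [onQubits, Matrix.of_apply, Function.Embedding.trans_apply]
  by_cases h : ∀ i, i ∉ Set.range f → x i = y i
  · rw [if_pos h]
    congr 1
    refine propext ⟨fun h' k hk => h' _ ?_, fun h' i hi => ?_⟩
    · rintro ⟨m, hm⟩
      exact hk ⟨m, f.injective hm⟩
    · by_cases hif : i ∈ Set.range f
      · obtain ⟨k, rfl⟩ := hif
        exact h' k (by rintro ⟨m, rfl⟩; exact hi ⟨m, rfl⟩)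
      · exact h i hif
  · rw [if_neg h, if_neg]
    intro h'
    exact h fun i hi => h' i (by rintro ⟨m, rfl⟩; exact hi ⟨_, rfl⟩)

theorem onQubits_injective (e : κ ↪ ι) : Function.Injective (onQubits e) := by
  intro A B h
  ext a b
  have hx : ∀ a : κ → Bool, (fun k => Function.extend e a (fun _ => false) (e k)) = a := fun a =>
    funext fun k => e.injective.extend_apply _ _ _
  have hab : ∀ i, i ∉ Set.range e → Function.extend e a (fun _ => false) i =
      Function.extend e b (fun _ => false) i := fun i hi => by
    rw [Function.extend_apply' _ _ _ hi, Function.extend_apply' _ _ _ hi]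
  have := congrFun (congrFun h (Function.extend e a fun _ => false))
    (Function.extend e b fun _ => false)
  rwa [onQubits_apply_of_agree e _ hab, onQubits_apply_of_agree e _ hab, hx, hx] at this

/-- `onQubits` as a unital homomorphism of C⋆-algebras. -/
def onQubitsHom (e : κ ↪ ι) : QOp κ →⋆ₐ[ℂ] QOp ι where
  toFun := onQubits e
  map_one' := onQubits_one e
  map_mul' := onQubits_mul e
  map_zero' := by simpa using onQubits_smul e 0 0
  map_add' := onQubits_add e
  commutes' c := by
    rw [Algebra.algebraMap_eq_smul_one, Algebra.algebraMap_eq_smul_one, onQubits_smul, onQubits_one]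
  map_star' := onQubits_conjTranspose e

theorem onQubitsHom_apply (e : κ ↪ ι) (A : QOp κ) : onQubitsHom e A = onQubits e A := rfl

theorem onQubits_mem_unitary (e : κ ↪ ι) {A : QOp κ} (hA : A ∈ QUnitary κ) :
    onQubits e A ∈ QUnitary ι :=
  Unitary.map_mem (onQubitsHom e) hA

theorem bitProj_eq_onQubits (e : κ ↪ ι) (k : κ) (b : Bool) :
    onQubits e (bitProj k b) = bitProj (e k) b :=
  onQubits_diagonal e _

theorem bitProj_mul_self (i : ι) (b : Bool) : bitProj i b * bitProj i b = bitProj i b := by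
  rw [bitProj, Matrix.diagonal_mul_diagonal]
  congr 1; funext x; split_ifs <;> simp

theorem bitProj_mul_of_ne (i : ι) {b b' : Bool} (h : b ≠ b') : bitProj i b * bitProj i b' = 0 := by
  rw [bitProj, bitProj, Matrix.diagonal_mul_diagonal, ← Matrix.diagonal_zero]
  congr 1; funext x; split_ifs <;> simp_all

theorem bitProj_add (i : ι) : bitProj i false + bitProj i true = (1 : QOp ι) := by
  rw [bitProj, bitProj, Matrix.diagonal_add, ← Matrix.diagonal_one]
  congr 1; funext x; cases x i <;> simp

theorem bitProj_conjTranspose (i : ι) (b : Bool) : (bitProj i b).conjTranspose = bitProj i b := by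
  rw [bitProj, Matrix.diagonal_conjTranspose]
  congr 1; funext x; simp only [Pi.star_apply]; split_ifs <;> simp

end OnQubits

/-! ### Permutation and diagonal unitaries, circuits, diagonalization -/

section Circuits

variable {ι κ : Type} [Fintype ι] [DecidableEq ι] [Fintype κ] [DecidableEq κ]

/-- The operator permuting the computational basis by `σ`. -/
def permOp (σ : (ι → Bool) → ι → Bool) : QOp ι := Matrix.of fun x y => if x = σ y then 1 else 0

theorem permOp_mul_apply {σ : (ι → Bool) → ι → Bool} (hσ : Function.Involutive σ) (M : QOp ι)
    (x y : ι → Bool) : (permOp σ * M) x y = M (σ x) y := by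
  rw [Matrix.mul_apply, Finset.sum_eq_single (σ x)]
  · simp [permOp, hσ x]
  · intro z _ hz
    simp only [permOp, Matrix.of_apply]
    rw [if_neg, zero_mul]
    rintro rfl
    exact hz (hσ z).symm
  · simp

theorem permOp_conjTranspose {σ : (ι → Bool) → ι → Bool} (hσ : Function.Involutive σ) :
    (permOp σ).conjTranspose = permOp σ := by
  ext x y
  simp only [permOp, Matrix.conjTranspose_apply, Matrix.of_apply]
  rw [apply_ite star, star_one, star_zero]
  congr 1
  exact propext ⟨fun h => by rw [h, hσ], fun h => by rw [h, hσ]⟩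

theorem permOp_mul_self {σ : (ι → Bool) → ι → Bool} (hσ : Function.Involutive σ) :
    permOp σ * permOp σ = 1 := by
  ext x y
  rw [permOp_mul_apply hσ, permOp, Matrix.of_apply, Matrix.one_apply]
  congr 1
  exact propext hσ.injective.eq_iff

theorem permOp_mem_unitary {σ : (ι → Bool) → ι → Bool} (hσ : Function.Involutive σ) :
    permOp σ ∈ QUnitary ι := by
  rw [Matrix.mem_unitaryGroup_iff, Matrix.star_eq_conjTranspose, permOp_conjTranspose hσ,
    permOp_mul_self hσ]

theorem permOp_mul_diagonal {σ : (ι → Bool) → ι → Bool} (hσ : Function.Involutive σ)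
    (d : (ι → Bool) → ℂ) :
    permOp σ * Matrix.diagonal d = Matrix.diagonal (fun x => d (σ x)) * permOp σ := by
  ext x y
  rw [permOp_mul_apply hσ, Matrix.diagonal_mul, permOp, Matrix.of_apply, Matrix.diagonal_apply]
  have : σ x = y ↔ x = σ y := ⟨fun h => by rw [← h, hσ], fun h => by rw [h, hσ]⟩
  by_cases h : σ x = y
  · rw [if_pos h, if_pos (this.1 h), mul_one]
  · rw [if_neg h, if_neg (mt this.2 h), mul_zero]

theorem diagonal_mem_unitary {d : (ι → Bool) → ℂ} (hd : ∀ x, ‖d x‖ = 1) :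
    Matrix.diagonal d ∈ QUnitary ι := by
  rw [Matrix.mem_unitaryGroup_iff, Matrix.star_eq_conjTranspose, Matrix.diagonal_conjTranspose,
    Matrix.diagonal_mul_diagonal, ← Matrix.diagonal_one]
  congr 1
  funext x
  simp [Complex.mul_conj, Complex.normSq_eq_norm_sq, hd x]

theorem hasCircuit_one (T : ℕ) : HasCircuit T (1 : QOp ι) := ⟨[], by simp, by simp, by simp⟩

theorem HasCircuit.mono {T T' : ℕ} (h : T ≤ T') {U : QOp ι} (hU : HasCircuit T U) :
    HasCircuit T' U := by
  obtain ⟨L, h1, h2⟩ := hU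
  exact ⟨L, h1.trans h, h2⟩

theorem IsGate.hasCircuit {U : QOp ι} (hU : IsGate U) : HasCircuit 1 U :=
  ⟨[U], by simp, by simpa using hU, by simp⟩

theorem HasCircuit.mul {T T' : ℕ} {U U' : QOp ι} (hU : HasCircuit T U) (hU' : HasCircuit T' U') :
    HasCircuit (T + T') (U * U') := by
  obtain ⟨L, h1, h2, rfl⟩ := hU
  obtain ⟨L', h1', h2', rfl⟩ := hU'
  refine ⟨L ++ L', by simp; omega, ?_, by simp⟩
  intro g hg
  rcases List.mem_append.1 hg with h | h
  exacts [h2 g h, h2' g h]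

theorem IsGate.conjTranspose {U : QOp ι} (hU : IsGate U) : IsGate U.conjTranspose := by
  obtain ⟨k, e, V, hk, rfl⟩ := hU
  exact ⟨k, e, star V, hk, (onQubits_conjTranspose e V.1).symm⟩

theorem HasCircuit.conjTranspose {T : ℕ} {U : QOp ι} (hU : HasCircuit T U) :
    HasCircuit T U.conjTranspose := by
  obtain ⟨L, h1, h2, rfl⟩ := hU
  refine ⟨(L.map Matrix.conjTranspose).reverse, by simpa using h1, ?_, ?_⟩
  · intro g hg
    obtain ⟨g', hg', rfl⟩ := List.mem_map.1 (List.mem_reverse.1 hg)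
    exact (h2 g' hg').conjTranspose
  · rw [Matrix.conjTranspose_list_prod]

theorem IsGate.onQubits {U : QOp κ} (hU : IsGate U) (e : κ ↪ ι) : IsGate (onQubits e U) := by
  obtain ⟨k, f, V, hk, rfl⟩ := hU
  exact ⟨k, f.trans e, V, hk, (onQubits_trans f e V.1).symm⟩

theorem HasCircuit.mem_unitary {T : ℕ} {U : QOp ι} (hU : HasCircuit T U) : U ∈ QUnitary ι := by
  obtain ⟨L, -, h2, rfl⟩ := hU
  refine Submonoid.list_prod_mem _ fun g hg => ?_
  obtain ⟨k, e, V, -, rfl⟩ := h2 g hg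
  exact onQubits_mem_unitary e V.2

/-- A unitary matrix is diagonal in some orthonormal basis. -/
theorem exists_diagonalization {n : Type} [Fintype n] [DecidableEq n] {U : Matrix n n ℂ}
    (hU : U ∈ Matrix.unitaryGroup n ℂ) :
    ∃ Q ∈ Matrix.unitaryGroup n ℂ, ∃ d : n → ℂ, (∀ a, ‖d a‖ = 1) ∧
      U = Q * Matrix.diagonal d * Q.conjTranspose := by
  -- The spectrum is finite and the unit circle is infinite.
  obtain ⟨z, hz, hzU⟩ : ∃ z : ℂ, ‖z‖ = 1 ∧ z ∉ spectrum ℂ U := by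
    by_contra! h
    have hinf : (Metric.sphere (0 : ℂ) 1).Infinite := by
      have : Function.Injective fun t : Set.Icc (-1 : ℝ) 1 =>
          (⟨t, Real.sqrt (1 - t ^ 2)⟩ : ℂ) := fun s t hst => by
        have := congrArg Complex.re hst
        exact Subtype.ext this
      have h2 : (Set.range fun t : Set.Icc (-1 : ℝ) 1 =>
          (⟨t, Real.sqrt (1 - t ^ 2)⟩ : ℂ)).Infinite := by
        have : Infinite (Set.Icc (-1 : ℝ) 1) := (Set.Icc_infinite (by norm_num)).to_subtype
        exact Set.infinite_range_of_injective ‹_›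
      refine h2.mono ?_
      rintro _ ⟨⟨t, ht⟩, rfl⟩
      rw [mem_sphere_zero_iff_norm, ← sq_eq_sq₀ (norm_nonneg _) zero_le_one, Complex.sq_norm,
        Complex.normSq_mk, Real.mul_self_sqrt (by nlinarith [ht.1, ht.2])]
      ring
    exact hinf ((Matrix.finite_spectrum U).subset fun z hz => h z (by simpa using hz))
  -- Rotating U by −z̄ moves the missing spectral value z to −1, so that 1 + v is invertible and the
  -- Cayley transform of v is defined.
  set v : Matrix n n ℂ := -(star z) • U with hv
  have hzz : z * star z = 1 := by
    simp [Complex.mul_conj, Complex.normSq_eq_norm_sq, hz]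
  have hvu : v.conjTranspose * v = 1 := by
    have := Matrix.mem_unitaryGroup_iff'.1 hU
    rw [Matrix.star_eq_conjTranspose] at this
    rw [hv, Matrix.conjTranspose_smul, smul_mul_smul_comm, this]
    simp [show z * starRingEnd ℂ z = 1 from hzz]
  have hunit : IsUnit (1 + v) := by
    have h1 : IsUnit (algebraMap ℂ (Matrix n n ℂ) z - U) := by
      simpa [spectrum.mem_iff] using hzU
    have h2 : 1 + v = star z • (algebraMap ℂ (Matrix n n ℂ) z - U) := by
      rw [hv, smul_sub, Algebra.algebraMap_eq_smul_one, smul_smul, mul_comm, hzz, one_smul,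
        neg_smul, sub_eq_add_neg]
    rw [h2]
    have hz0 : star z ≠ 0 := by rintro h; rw [h] at hzz; simp at hzz
    exact (isUnit_smul_iff (Units.mk0 _ hz0) _).2 h1
  obtain ⟨⟨w, w', hw, hw'⟩, rfl : w = 1 + v⟩ := hunit
  -- The Cayley transform of the unitary v is Hermitian. The spectral theorem applies to it, and an
  -- eigenbasis of h also diagonalizes v.
  set h : Matrix n n ℂ := Complex.I • ((1 - v) * w') with hh
  have hmul : h * (1 + v) = Complex.I • (1 - v) := by
    rw [hh, smul_mul_assoc, mul_assoc, hw', mul_one]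
  have hherm : h.IsHermitian := by
    have hvv : v * v.conjTranspose = 1 := mul_eq_one_comm.1 hvu
    have e1 : w'.conjTranspose * (1 + v.conjTranspose) = 1 := by
      have := congrArg Matrix.conjTranspose hw
      simpa using this
    have e2 : w'.conjTranspose * (1 + v) = v := by
      calc _ = w'.conjTranspose * (1 + v.conjTranspose) * v := by
            rw [mul_assoc, add_mul, one_mul, hvu, add_comm]
        _ = v := by rw [e1, one_mul]
    have e3 : w'.conjTranspose = v * w' := by
      calc _ = w'.conjTranspose * (1 + v) * w' := by rw [mul_assoc, hw, mul_one]
        _ = _ := by rw [e2]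
    have hcomm : v * w' = w' * v := by
      have : w' * ((1 + v) * v) * w' = w' * (v * (1 + v)) * w' := by noncomm_ring
      have l : w' * ((1 + v) * v) * w' = v * w' := by rw [← mul_assoc, hw', one_mul]
      have r : w' * (v * (1 + v)) * w' = w' * v := by
        rw [mul_assoc, mul_assoc, hw, mul_one]
      rw [← l, this, r]
    rw [Matrix.IsHermitian, hh, Matrix.conjTranspose_smul, Matrix.conjTranspose_mul, e3]
    have : v * w' * (1 - v).conjTranspose = -((1 - v) * w') := by
      simp only [Matrix.conjTranspose_sub, Matrix.conjTranspose_one, mul_sub, sub_mul, one_mul,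
        mul_one]
      rw [hcomm, mul_assoc, hvv, mul_one]
      abel
    rw [this]
    simp
  obtain ⟨Q, l, hspec⟩ : ∃ (Q : Matrix.unitaryGroup n ℂ) (l : n → ℝ),
      h = Q.1 * Matrix.diagonal (fun a => (l a : ℂ)) * Q.1.conjTranspose := by
    refine ⟨hherm.eigenvectorUnitary, hherm.eigenvalues, ?_⟩
    have := hherm.spectral_theorem
    rw [Unitary.conjStarAlgAut_apply] at this
    exact this
  have hQ : Q.1.conjTranspose * Q.1 = 1 := Matrix.mem_unitaryGroup_iff'.1 Q.2
  have hQ' : Q.1 * Q.1.conjTranspose = 1 := Matrix.mem_unitaryGroup_iff.1 Q.2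
  set u := Q.1.conjTranspose * v * Q.1 with hu
  have hdiag : ∀ a b, a ≠ b → u a b = 0 := by
    have e : Matrix.diagonal (fun a => (l a : ℂ)) * (1 + u) =
        Complex.I • (1 - u) := by
      have h1 : Q.1.conjTranspose * (h * (1 + v)) * Q.1 =
          Q.1.conjTranspose * (Complex.I • (1 - v)) * Q.1 := by rw [hmul]
      have l : Q.1.conjTranspose * (h * (1 + v)) * Q.1 =
          Matrix.diagonal (fun a => (l a : ℂ)) * (1 + u) := by
        rw [hspec]
        calc _ = (Q.1.conjTranspose * Q.1) * Matrix.diagonal (fun a => (l a : ℂ)) *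
              (Q.1.conjTranspose * Q.1 + Q.1.conjTranspose * v * Q.1) := by noncomm_ring
          _ = _ := by rw [hQ, one_mul]
      have r : Q.1.conjTranspose * (Complex.I • (1 - v)) * Q.1 = Complex.I • (1 - u) := by
        rw [mul_smul_comm, smul_mul_assoc]
        congr 1
        calc _ = Q.1.conjTranspose * Q.1 - Q.1.conjTranspose * v * Q.1 := by noncomm_ring
          _ = _ := by rw [hQ]
      rw [← l, h1, r]
    intro a b hab
    have := congrFun (congrFun e a) b
    rw [Matrix.diagonal_mul] at this
    simp only [Matrix.add_apply, Matrix.smul_apply, Matrix.sub_apply, Matrix.one_apply_ne hab,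
      smul_eq_mul, zero_add, zero_sub] at this
    -- An off-diagonal entry of l (1 + u) = i (1 − u); since `l a` is real, the factor l a + i
    -- cannot vanish.
    have h0 : ((l a : ℂ) + Complex.I) * u a b = 0 := by
      linear_combination this
    refine (mul_eq_zero.1 h0).resolve_left fun h => ?_
    have := congrArg Complex.im h
    simp at this
  have hUQ : Q.1.conjTranspose * U * Q.1 = Matrix.diagonal fun a => -z * u a a := by
    have : Q.1.conjTranspose * U * Q.1 = -z • u := by
      rw [hu, hv, mul_smul_comm, smul_mul_assoc, smul_smul, neg_mul_neg, hzz, one_smul]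
    rw [this]
    ext a b
    by_cases hab : a = b
    · subst hab; simp
    · rw [Matrix.smul_apply, hdiag a b hab, Matrix.diagonal_apply_ne _ hab, smul_zero]
  refine ⟨Q.1, Q.2, fun a => -z * u a a, ?_, ?_⟩
  swap
  · rw [← hUQ]
    calc U = (Q.1 * Q.1.conjTranspose) * U * (Q.1 * Q.1.conjTranspose) := by
          rw [hQ', one_mul, mul_one]
      _ = _ := by noncomm_ring
  · intro a
    have hmem : Q.1.conjTranspose * U * Q.1 ∈ Matrix.unitaryGroup n ℂ :=
      mul_mem (mul_mem (star Q).2 hU) Q.2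
    rw [hUQ, Matrix.mem_unitaryGroup_iff, Matrix.star_eq_conjTranspose,
      Matrix.diagonal_conjTranspose, Matrix.diagonal_mul_diagonal] at hmem
    have := congrFun (congrFun hmem a) a
    rw [Matrix.diagonal_apply_eq, Matrix.one_apply_eq, Pi.star_apply] at this
    have h2 := congrArg norm this
    rw [norm_mul, norm_star, norm_one] at h2
    nlinarith [norm_nonneg (-z * u a a)]

end Circuits

/-! ### Controlled operations and their compilation into gates -/

section Controlled

variable {ι κ μ : Type} [Fintype ι] [DecidableEq ι] [Fintype κ] [DecidableEq κ]
  [Fintype μ] [DecidableEq μ]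

theorem bitProj_commute_onQubits {c : ι} {j : κ ↪ ι} (hc : c ∉ Set.range j) (b : Bool)
    (A : QOp κ) : Commute (bitProj c b) (onQubits j A) := by
  have h := onQubits_commute (⟨fun _ : Unit => c, fun _ _ _ => rfl⟩ : Unit ↪ ι) j
    (by
      rw [Set.disjoint_left]
      rintro _ ⟨_, rfl⟩
      exact hc) (bitProj () b) A
  rwa [bitProj_eq_onQubits] at h

/-- The operator `A` on the qubits in the range of `j`, controlled by the qubit `c`. -/
def controlled (c : ι) (j : κ ↪ ι) (A : QOp κ) : QOp ι :=
  bitProj c false + bitProj c true * onQubits j A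

theorem bitProj_false_mul_true (c : ι) : bitProj c false * bitProj c true = 0 :=
  bitProj_mul_of_ne c (by simp)

theorem bitProj_true_mul_false (c : ι) : bitProj c true * bitProj c false = 0 :=
  bitProj_mul_of_ne c (by simp)

theorem controlled_mul {c : ι} {j : κ ↪ ι} (hc : c ∉ Set.range j) (A B : QOp κ) :
    controlled c j (A * B) = controlled c j A * controlled c j B := by
  have hA := (bitProj_commute_onQubits hc true A).eq
  have hA' := (bitProj_commute_onQubits hc false A).eq
  simp only [controlled, onQubits_mul, add_mul, mul_add, bitProj_mul_self]
  have h1 : bitProj c false * (bitProj c true * onQubits j B) = 0 := by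
    rw [← mul_assoc, bitProj_false_mul_true, zero_mul]
  have h2 : bitProj c true * onQubits j A * bitProj c false = 0 := by
    rw [mul_assoc, ← hA', ← mul_assoc, bitProj_true_mul_false, zero_mul]
  have h3 : bitProj c true * onQubits j A * (bitProj c true * onQubits j B) =
      bitProj c true * (onQubits j A * onQubits j B) := by
    rw [mul_assoc, ← mul_assoc (onQubits j A), ← hA, ← mul_assoc, ← mul_assoc, bitProj_mul_self,
      mul_assoc]
  rw [h1, h2, h3, add_zero, zero_add]

theorem controlled_one (c : ι) (j : κ ↪ ι) : controlled c j 1 = 1 := by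
  rw [controlled, onQubits_one, mul_one, bitProj_add]

theorem controlled_conjTranspose {c : ι} {j : κ ↪ ι} (hc : c ∉ Set.range j) (A : QOp κ) :
    controlled c j A.conjTranspose = (controlled c j A).conjTranspose := by
  rw [controlled, controlled, Matrix.conjTranspose_add, Matrix.conjTranspose_mul,
    bitProj_conjTranspose, bitProj_conjTranspose, onQubits_conjTranspose,
    ← onQubits_conjTranspose, (bitProj_commute_onQubits hc true _).eq]

theorem controlled_mem_unitary {c : ι} {j : κ ↪ ι} (hc : c ∉ Set.range j) {A : QOp κ}
    (hA : A ∈ QUnitary κ) : controlled c j A ∈ QUnitary ι := by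
  rw [Matrix.mem_unitaryGroup_iff, Matrix.star_eq_conjTranspose, ← controlled_conjTranspose hc,
    ← controlled_mul hc, ← Matrix.star_eq_conjTranspose, Matrix.mem_unitaryGroup_iff.1 hA,
    controlled_one]

/-- On the block where the control is 0, Q and its adjoint cancel. Hence conjugating unitaries need
not be controlled, which keeps them within two qubits. -/
theorem controlled_conj {c : ι} {j : κ ↪ ι} (hc : c ∉ Set.range j) {Q : QOp κ}
    (hQ : Q ∈ QUnitary κ) (A : QOp κ) :
    controlled c j (Q * A * Q.conjTranspose) =
      onQubits j Q * controlled c j A * (onQubits j Q).conjTranspose := by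
  have h1 := (bitProj_commute_onQubits hc true Q).eq
  have h2 := (bitProj_commute_onQubits hc false Q).eq
  have h3 : onQubits j Q * (onQubits j Q).conjTranspose = 1 :=
    Matrix.mem_unitaryGroup_iff.1 (onQubits_mem_unitary j hQ)
  rw [controlled, controlled, onQubits_mul, onQubits_mul, onQubits_conjTranspose, mul_add, add_mul,
    ← h2, mul_assoc (bitProj c false), h3, mul_one, ← mul_assoc (onQubits j Q), ← h1]
  simp only [mul_assoc]

theorem controlled_onQubits (c : ι) (j : κ ↪ ι) (e : μ ↪ κ) (A : QOp μ) :
    controlled c j (onQubits e A) = controlled c (e.trans j) A := by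
  rw [controlled, controlled, onQubits_trans]

/-- The control occupies one of the at most two qubits of a gate, hence the restriction `k ≤ 1`. -/
theorem isGate_controlled {c : ι} {k : ℕ} {e : Fin k ↪ ι} (hc : c ∉ Set.range e) (hk : k ≤ 1)
    {A : QOp (Fin k)} (hA : A ∈ QUnitary (Fin k)) : IsGate (controlled c e A) := by
  have hinj : Function.Injective (Fin.cons c e : Fin (k + 1) → ι) :=
    Fin.cons_injective_iff.2 ⟨hc, e.injective⟩
  have h0 : (0 : Fin (k + 1)) ∉ Set.range (Fin.succEmb k) := by
    rintro ⟨i, hi⟩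
    exact Fin.succ_ne_zero i hi
  set f : Fin (k + 1) ↪ ι := ⟨_, hinj⟩ with hf
  have h1 : (Fin.succEmb k).trans f = e := by
    ext i
    simp [hf]
  have h2 : f 0 = c := rfl
  refine ⟨k + 1, f, ⟨controlled 0 (Fin.succEmb k) A, controlled_mem_unitary h0 hA⟩, by omega, ?_⟩
  simp only [controlled]
  rw [onQubits_add, onQubits_mul, bitProj_eq_onQubits, bitProj_eq_onQubits, ← onQubits_trans, h1,
    h2]

/-- A diagonal two-qubit unitary is, up to one-qubit unitaries, a CNOT-conjugate of a one-qubit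
unitary. -/
theorem exists_phases {d : (Fin 2 → Bool) → ℂ} (hd : ∀ x, ‖d x‖ = 1) :
    ∃ u v w : Bool → ℂ, (∀ b, ‖u b‖ = 1) ∧ (∀ b, ‖v b‖ = 1) ∧ (∀ b, ‖w b‖ = 1) ∧
      ∀ x, d x = u (x 0) * v (x 1) * w (xor (x 0) (x 1)) := by
  have harg : ∀ x, d x = Complex.exp ((d x).arg * Complex.I) := fun x => by
    have := Complex.norm_mul_exp_arg_mul_I (d x)
    rw [hd, Complex.ofReal_one, one_mul] at this
    exact this.symm
  set t : Bool → Bool → ℝ := fun a b => (d ![a, b]).arg with ht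
  set δ := (t true false + t false true - t true true - t false false) / 2 with hδ
  have hn : ∀ r : ℝ, ‖Complex.exp (r * Complex.I)‖ = 1 := Complex.norm_exp_ofReal_mul_I
  refine ⟨fun a => Complex.exp (((bif a then t true false - δ else t false false : ℝ) : ℂ) *
      Complex.I),
    fun b => Complex.exp (((bif b then t false true - t false false - δ else 0 : ℝ) : ℂ) *
      Complex.I),
    fun b => Complex.exp (((bif b then δ else 0 : ℝ) : ℂ) * Complex.I),
    fun b => hn _, fun b => hn _, fun b => hn _, fun x => ?_⟩
  have hx : x = ![x 0, x 1] := by funext i; fin_cases i <;> rfl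
  rw [harg, ← Complex.exp_add, ← Complex.exp_add, ← add_mul, ← add_mul, ← Complex.ofReal_add,
    ← Complex.ofReal_add]
  congr 3
  have : (d x).arg = t (x 0) (x 1) := by rw [ht]; simp only; rw [← hx]
  rw [this]
  cases x 0 <;> cases x 1 <;> simp [hδ] <;> ring

/-- The qubit `i` alone. -/
def oneQubit (i : ι) : Fin 1 ↪ ι := ⟨fun _ => i, fun _ _ _ => Subsingleton.elim _ _⟩

theorem hasCircuit_controlled_gate {c : ι} {j : κ ↪ ι} (hc : c ∉ Set.range j) {g : QOp κ}
    (hg : IsGate g) : HasCircuit 7 (controlled c j g) := by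
  obtain ⟨k, e, ⟨V, hV⟩, hk, rfl⟩ := hg
  rw [controlled_onQubits]
  have hce : c ∉ Set.range (e.trans j) := by
    rintro ⟨i, hi⟩
    exact hc ⟨_, hi⟩
  generalize e.trans j = f at hce
  rcases Nat.lt_or_ge k 2 with h | h
  · exact (isGate_controlled hce (by omega) hV).hasCircuit.mono (by norm_num)
  obtain rfl : k = 2 := le_antisymm hk h
  obtain ⟨Q, hQ, d, hd, rfl⟩ := exists_diagonalization hV
  obtain ⟨u, v, w, hu, hv, hw, hduvw⟩ := exists_phases hd
  set cnot : (Fin 2 → Bool) → Fin 2 → Bool := fun x => ![x 0, xor (x 0) (x 1)] with hcnot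
  have hinv : Function.Involutive cnot := fun x => by
    funext i
    fin_cases i
    · rfl
    · simp [hcnot]
  set N : QOp (Fin 2) := permOp cnot
  have hN : N ∈ QUnitary (Fin 2) := permOp_mem_unitary hinv
  have hdiag : Matrix.diagonal d =
      onQubits (oneQubit 0) (Matrix.diagonal fun x : Fin 1 → Bool => u (x 0)) *
      onQubits (oneQubit 1) (Matrix.diagonal fun x : Fin 1 → Bool => v (x 0)) *
      (N * onQubits (oneQubit 1) (Matrix.diagonal fun x : Fin 1 → Bool => w (x 0)) *
        N.conjTranspose) := by
    rw [onQubits_diagonal, onQubits_diagonal, onQubits_diagonal, permOp_mul_diagonal hinv,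
      permOp_conjTranspose hinv, mul_assoc _ N, permOp_mul_self hinv, mul_one,
      Matrix.diagonal_mul_diagonal, Matrix.diagonal_mul_diagonal]
    congr 1
    funext x
    rw [hduvw]
    rfl
  have hone : ∀ (i : Fin 2) (s : Bool → ℂ), (∀ b, ‖s b‖ = 1) →
      HasCircuit 1 (controlled c f
        (onQubits (oneQubit i) (Matrix.diagonal fun x : Fin 1 → Bool => s (x 0)))) := by
    intro i s hs
    rw [controlled_onQubits]
    refine (isGate_controlled ?_ le_rfl (diagonal_mem_unitary fun x => hs _)).hasCircuit
    rintro ⟨a, ha⟩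
    exact hce ⟨_, ha⟩
  have hgate : ∀ {X : QOp (Fin 2)}, X ∈ QUnitary (Fin 2) → HasCircuit 1 (onQubits f X) :=
    fun {X} hX => IsGate.hasCircuit ⟨2, f, ⟨X, hX⟩, le_rfl, rfl⟩
  rw [controlled_conj hce hQ, hdiag, controlled_mul hce, controlled_mul hce, controlled_conj hce hN]
  -- Seven gates: Q, the controlled phases u and v, CNOT, the controlled phase w, CNOT, Q†. Only the
  -- one-qubit diagonal factors carry the control.
  exact ((hgate hQ).mul (((hone 0 u hu).mul (hone 1 v hv)).mul
    (((hgate hN).mul (hone 1 w hw)).mul (hgate hN).conjTranspose))).mul (hgate hQ).conjTranspose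

theorem HasCircuit.controlled {c : ι} {j : κ ↪ ι} (hc : c ∉ Set.range j) {T : ℕ} {U : QOp κ}
    (hU : HasCircuit T U) : HasCircuit (7 * T) (controlled c j U) := by
  obtain ⟨L, h1, h2, rfl⟩ := hU
  refine HasCircuit.mono (Nat.mul_le_mul_left 7 h1) ?_
  clear h1
  induction L with
  | nil =>
    rw [List.prod_nil, controlled_one]
    exact hasCircuit_one _
  | cons g L ih =>
    rw [List.prod_cons, controlled_mul hc, List.length_cons,
      show 7 * (L.length + 1) = 7 + 7 * L.length by ring]
    exact (hasCircuit_controlled_gate hc (h2 g List.mem_cons_self)).mul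
      (ih fun g hg => h2 g (List.mem_cons_of_mem _ hg))

end Controlled

/-! ### Expansion of the evolution under oracle queries -/

section History

variable {𝒜 : Type*} [CStarAlgebra 𝒜]

theorem norm_le_one_of_mem_unitary {U : 𝒜} (hU : U ∈ unitary 𝒜) : ‖U‖ ≤ 1 := by
  nontriviality 𝒜
  exact (CStarRing.norm_of_mem_unitary hU).le

/-- The unitary that acts as `O` on the range of `P` and trivially on its complement. -/
def condUnitary (O P : 𝒜) : 𝒜 := O * P + (1 - P)

/-- As `O` commutes with `P`, the operator is block diagonal, with the blocks `O` and 1, and its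
adjoint has the same form with `star O`. -/
theorem condUnitary_mem_unitary {O P : 𝒜} (hO : O ∈ unitary 𝒜) (hP : IsStarProjection P)
    (hOP : Commute O P) : condUnitary O P ∈ unitary 𝒜 := by
  have hi := hP.isIdempotentElem.eq
  have hs := hP.isSelfAdjoint.star_eq
  have hOP' : Commute (star O) P := by
    have := hOP.star_star
    rwa [hs] at this
  have h1 : P * (1 - P) = 0 := by rw [mul_sub, mul_one, hi, sub_self]
  have h2 : (1 - P) * P = 0 := by rw [sub_mul, one_mul, hi, sub_self]
  have h3 : (1 - P) * (1 - P) = 1 - P := by rw [mul_sub, mul_one, h2, sub_zero]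
  have aux : ∀ X Y : 𝒜, X * Y = 1 → Commute Y P →
      (X * P + (1 - P)) * (Y * P + (1 - P)) = 1 := by
    intro X Y hXY hY
    have e1 : X * P * (Y * P) = P := by
      rw [mul_assoc, ← mul_assoc P, ← hY.eq, mul_assoc Y, hi, ← mul_assoc, hXY, one_mul]
    have e2 : X * P * (1 - P) = 0 := by rw [mul_assoc, h1, mul_zero]
    have e3 : (1 - P) * (Y * P) = 0 := by rw [hY.eq, ← mul_assoc, h2, zero_mul]
    rw [add_mul, mul_add, mul_add, e1, e2, e3, h3]
    abel
  have hst : star (condUnitary O P) = star O * P + (1 - P) := by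
    rw [condUnitary, star_add, star_mul, star_sub, star_one, hs, hOP'.eq]
  rw [Unitary.mem_iff, hst]
  exact ⟨aux _ _ (Unitary.star_mul_self_of_mem hO) hOP,
    aux _ _ (Unitary.mul_star_self_of_mem hO) hOP'⟩

/-- `x` is a sum of at most `t + 1` terms `W k`, with `W` in `𝒱` and `k` in the range of `p`, such
that `y` is close to the sum of the terms `W S k`. -/
def IsHistory (𝒱 : Set 𝒜) (S p : 𝒜) (t : ℕ) (δ : ℝ) (x y : 𝒜) : Prop :=
  ‖x‖ ≤ 1 ∧ ‖y‖ ≤ 1 ∧ ∃ W k : ℕ → 𝒜, (∀ i ≤ t, W i ∈ 𝒱) ∧ (∀ i ≤ t, p * k i = k i ∧ ‖k i‖ ≤ 2) ∧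
    x = ∑ i ∈ Finset.range (t + 1), W i * k i ∧
    ‖y - ∑ i ∈ Finset.range (t + 1), W i * (S * k i)‖ ≤ 4 * (t : ℝ) ^ 2 * δ

/-- Before any query the expansion has one term and no error. -/
theorem isHistory_zero {𝒱 : Set 𝒜} {S P z : 𝒜} (hS : S ∈ unitary 𝒜)
    (hp : IsStarProjection (P * z)) {U : 𝒜} (hU : U ∈ unitary 𝒜) (hUV : U ∈ 𝒱) (δ : ℝ) :
    IsHistory 𝒱 S (P * z) 0 δ (U * (P * z)) (U * (S * (P * z))) := by
  have h1 := hp.norm_le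
  refine ⟨?_, ?_, fun _ => U, fun _ => P * z, fun _ _ => hUV,
    fun _ _ => ⟨hp.isIdempotentElem.eq, by linarith⟩, by simp, by simp⟩
  · rwa [CStarRing.norm_mem_unitary_mul _ hU]
  · rwa [CStarRing.norm_mem_unitary_mul _ hU, CStarRing.norm_mem_unitary_mul _ hS]

/-- A query with b = 0 sends x to x + (O − 1) P x, and the new term stays in the range of `P z`
because all the operators involved preserve that of `z`. With b = 1 the added term is s (O − 1) P s
y, which is close to `s` times the same new term because P s y is close to P x. -/
theorem IsHistory.query {𝒱 𝒱' : Set 𝒜} {S P z O : 𝒜} {t : ℕ} {δ : ℝ} {x y U : 𝒜}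
    (h : IsHistory 𝒱 S (P * z) t δ x y) (hδ : 0 ≤ δ) (hS : IsSelfAdjoint S) (hS2 : S * S = 1)
    (hP : IsStarProjection P) (hz : IsStarProjection z) (hSP : Commute S P) (hPz : Commute P z)
    (hO : O ∈ unitary 𝒜) (hOP : Commute O P) (hOz : Commute O z) (hU : U ∈ unitary 𝒜)
    (h𝒱z : ∀ W ∈ 𝒱, Commute W z) (hU𝒱 : U ∈ 𝒱') (hmul : ∀ W ∈ 𝒱, U * W ∈ 𝒱')
    (hδW : ∀ W ∈ 𝒱, ‖P * (W - S * W * S) * (P * z)‖ ≤ δ) :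
    IsHistory 𝒱' S (P * z) (t + 1) δ (U * condUnitary O P * x)
      (U * condUnitary (S * O * S) P * y) := by
  obtain ⟨hx1, hy1, W, k, hW, hk, hx, hy⟩ := h
  have hSu : S ∈ unitary 𝒜 := by
    rw [Unitary.mem_iff, hS.star_eq]; exact ⟨hS2, hS2⟩
  have hPi := hP.isIdempotentElem.eq
  have hG0 := condUnitary_mem_unitary hO hP hOP
  have hG1 := condUnitary_mem_unitary (mul_mem (mul_mem hSu hO) hSu) hP
    ((hSP.mul_left hOP).mul_left hSP)
  have hzk : ∀ i ≤ t, z * k i = k i := fun i hi => by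
    conv_lhs => rw [← (hk i hi).1]
    rw [hPz.eq, ← mul_assoc, ← mul_assoc, hz.isIdempotentElem.eq, ← hPz.eq, (hk i hi).1]
  have hzx : z * x = x := by
    rw [hx, Finset.mul_sum]
    refine Finset.sum_congr rfl fun i hi => ?_
    have hi' : i ≤ t := Nat.lt_succ_iff.1 (Finset.mem_range.1 hi)
    rw [← mul_assoc, ← (h𝒱z _ (hW i hi')).eq, mul_assoc, hzk i hi']
  set kn : 𝒜 := (O - 1) * (P * x) with hkn
  have hknP : P * z * kn = kn := by
    have h1 : Commute (P * z) (O - 1) :=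
      (Commute.sub_right (hOP.mul_right hOz).symm (Commute.one_right _))
    rw [hkn, ← mul_assoc, h1.eq, mul_assoc (O - 1)]
    congr 1
    rw [hPz.eq, mul_assoc, ← mul_assoc P P, hPi, ← mul_assoc, ← hPz.eq, mul_assoc, hzx]
  have hO1 : ‖O - 1‖ ≤ 2 := by
    refine (norm_sub_le _ _).trans ?_
    have h1 := norm_le_one_of_mem_unitary hO
    have h2 := norm_le_one_of_mem_unitary (one_mem (unitary 𝒜))
    linarith
  have hPx : ‖P * x‖ ≤ 1 := by
    refine (norm_mul_le _ _).trans ?_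
    exact mul_le_one₀ hP.norm_le (norm_nonneg _) hx1
  have hkn2 : ‖kn‖ ≤ 2 := by
    refine (norm_mul_le _ _).trans ?_
    nlinarith [norm_nonneg (O - 1), norm_nonneg (P * x)]
  have hG0x : condUnitary O P * x = x + kn := by
    rw [condUnitary, hkn]; noncomm_ring
  refine ⟨?_, ?_, fun i => if i ≤ t then U * W i else U, fun i => if i ≤ t then k i else kn,
    ?_, ?_, ?_, ?_⟩
  · rwa [mul_assoc, CStarRing.norm_mem_unitary_mul _ hU, CStarRing.norm_mem_unitary_mul _ hG0]
  · rwa [mul_assoc, CStarRing.norm_mem_unitary_mul _ hU, CStarRing.norm_mem_unitary_mul _ hG1]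
  · intro i _
    dsimp only
    split_ifs with h
    exacts [hmul _ (hW i h), hU𝒱]
  · intro i _
    dsimp only
    split_ifs with h
    exacts [hk i h, ⟨hknP, hkn2⟩]
  · rw [mul_assoc, hG0x, mul_add, Finset.sum_range_succ, hx, Finset.mul_sum]
    congr 1
    · refine Finset.sum_congr rfl fun i hi => ?_
      have hi' : i ≤ t := Nat.lt_succ_iff.1 (Finset.mem_range.1 hi)
      dsimp only
      rw [if_pos hi', if_pos hi', mul_assoc]
    · dsimp only
      rw [if_neg (by omega), if_neg (by omega)]
  · set yt : 𝒜 := ∑ i ∈ Finset.range (t + 1), W i * (S * k i) with hyt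
    have hsum : ∑ i ∈ Finset.range (t + 1 + 1), (if i ≤ t then U * W i else U) *
        (S * if i ≤ t then k i else kn) = U * (yt + S * kn) := by
      rw [Finset.sum_range_succ, if_neg (by omega), if_neg (by omega), mul_add, hyt,
        Finset.mul_sum]
      congr 1
      refine Finset.sum_congr rfl fun i hi => ?_
      have hi' : i ≤ t := Nat.lt_succ_iff.1 (Finset.mem_range.1 hi)
      rw [if_pos hi', if_pos hi', mul_assoc]
    rw [hsum]
    -- The new error is the old one, transported by a unitary, plus the error made by querying on s
    -- yt in place of x.
    have hdecomp : U * condUnitary (S * O * S) P * y - U * (yt + S * kn) =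
        U * (condUnitary (S * O * S) P * (y - yt) + S * ((O - 1) * (P * (S * yt - x)))) := by
      have : condUnitary (S * O * S) P * yt = yt + S * ((O - 1) * (P * (S * yt))) := by
        have e : S * P * S = P := by rw [hSP.eq, mul_assoc, hS2, mul_one]
        have e2 : S * ((O - 1) * (P * (S * yt))) = S * O * (P * S) * yt - (S * P * S) * yt := by
          noncomm_ring
        rw [e2, e, ← hSP.eq, condUnitary]
        noncomm_ring
      rw [mul_assoc, ← mul_sub, mul_sub (condUnitary (S * O * S) P), this, hkn]
      congr 1
      noncomm_ring
    -- Term by term, P (s W s − W) k is small by the compression bound: there are t + 1 terms, each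
    -- at most δ ‖k‖ ≤ 2δ.
    have herr : ‖P * (S * yt - x)‖ ≤ 2 * (t + 1) * δ := by
      have e : P * (S * yt - x) =
          ∑ i ∈ Finset.range (t + 1), -(P * (W i - S * W i * S) * (P * z) * k i) := by
        rw [hyt, hx, Finset.mul_sum, ← Finset.sum_sub_distrib, Finset.mul_sum]
        refine Finset.sum_congr rfl fun i hi => ?_
        have hi' : i ≤ t := Nat.lt_succ_iff.1 (Finset.mem_range.1 hi)
        rw [mul_assoc _ (P * z), (hk i hi').1]
        noncomm_ring
      rw [e]
      refine (norm_sum_le_of_le _ (f := fun i => -(P * (W i - S * W i * S) * (P * z) * k i))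
        (n := fun _ => 2 * δ) fun i hi => ?_).trans (le_of_eq ?_)
      · have hi' : i ≤ t := Nat.lt_succ_iff.1 (Finset.mem_range.1 hi)
        rw [norm_neg]
        refine (norm_mul_le _ _).trans ?_
        nlinarith [hδW _ (hW i hi'), (hk i hi').2, norm_nonneg (k i),
          norm_nonneg (P * (W i - S * W i * S) * (P * z))]
      · simp; ring
    rw [hdecomp, CStarRing.norm_mem_unitary_mul _ hU]
    refine (norm_add_le _ _).trans ?_
    rw [CStarRing.norm_mem_unitary_mul _ hG1, CStarRing.norm_mem_unitary_mul _ hSu]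
    have h2 : ‖(O - 1) * (P * (S * yt - x))‖ ≤ 2 * (2 * (t + 1) * δ) :=
      (norm_mul_le _ _).trans (mul_le_mul hO1 herr (norm_nonneg _) (by norm_num))
    -- The step adds 4 (t + 1) δ, and 4t² + 4(t + 1) ≤ 4(t + 1)².
    push_cast
    nlinarith [mul_nonneg (Nat.cast_nonneg (α := ℝ) t) hδ]

/-- Expanding both quadratic forms in histories with the same vectors k gives (t + 1)² differences
k†(V†BW − s V†BW s)k', each at most 4δ. The remaining summand is the cost of replacing y by its
approximate expansion. -/
theorem IsHistory.norm_conj_sub_le {𝒱 : Set 𝒜} {S p B : 𝒜} {t : ℕ} {δ : ℝ} {x y : 𝒜}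
    (h : IsHistory 𝒱 S p t δ x y) (hδ : 0 ≤ δ) (hS : IsSelfAdjoint S) (hp : IsSelfAdjoint p)
    (hB : ‖B‖ ≤ 1)
    (hδW : ∀ V ∈ 𝒱, ∀ W ∈ 𝒱,
      ‖p * (star V * B * W - S * (star V * B * W) * S) * p‖ ≤ δ) :
    ‖star x * B * x - star y * B * y‖ ≤
      4 * ((t : ℝ) + 1) ^ 2 * δ + 4 * t ^ 2 * δ * (2 + 4 * t ^ 2 * δ) := by
  obtain ⟨hx1, hy1, W, k, hW, hk, hx, hy⟩ := h
  set yt : 𝒜 := ∑ i ∈ Finset.range (t + 1), W i * (S * k i) with hyt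
  have h1 : ‖star x * B * x - star yt * B * yt‖ ≤ 4 * ((t : ℝ) + 1) ^ 2 * δ := by
    have e : star x * B * x - star yt * B * yt =
        ∑ i ∈ Finset.range (t + 1), ∑ j ∈ Finset.range (t + 1),
          star (k i) * (p * (star (W i) * B * W j - S * (star (W i) * B * W j) * S) * p) *
            k j := by
      have hsum : ∀ f : ℕ → 𝒜, star (∑ i ∈ Finset.range (t + 1), f i) * B *
          ∑ j ∈ Finset.range (t + 1), f j = ∑ i ∈ Finset.range (t + 1),
            ∑ j ∈ Finset.range (t + 1), star (f i) * B * f j := fun f => by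
        rw [star_sum, Finset.sum_mul, Finset.sum_mul_sum]
      rw [hx, hyt, hsum, hsum, ← Finset.sum_sub_distrib]
      refine Finset.sum_congr rfl fun i hi => ?_
      rw [← Finset.sum_sub_distrib]
      refine Finset.sum_congr rfl fun j hj => ?_
      have hi' : i ≤ t := Nat.lt_succ_iff.1 (Finset.mem_range.1 hi)
      have hj' : j ≤ t := Nat.lt_succ_iff.1 (Finset.mem_range.1 hj)
      have hki : star (k i) * p = star (k i) := by
        rw [← hp.star_eq, ← star_mul, (hk i hi').1]
      have hkj := (hk j hj').1
      calc _ = star (k i) * (star (W i) * B * W j - S * (star (W i) * B * W j) * S) * k j := by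
            rw [star_mul, star_mul, star_mul, hS.star_eq]
            noncomm_ring
        _ = (star (k i) * p) * (star (W i) * B * W j - S * (star (W i) * B * W j) * S) *
            (p * k j) := by rw [hki, hkj]
        _ = _ := by noncomm_ring
    rw [e]
    refine (norm_sum_le_of_le _ (n := fun _ => ((t : ℝ) + 1) * (4 * δ)) fun i hi => ?_).trans
      (le_of_eq ?_)
    · refine (norm_sum_le_of_le _ (n := fun _ => 4 * δ) fun j hj => ?_).trans (le_of_eq ?_)
      · have hi' : i ≤ t := Nat.lt_succ_iff.1 (Finset.mem_range.1 hi)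
        have hj' : j ≤ t := Nat.lt_succ_iff.1 (Finset.mem_range.1 hj)
        refine (norm_mul_le _ _).trans ?_
        have a1 : ‖star (k i) * (p * (star (W i) * B * W j - S * (star (W i) * B * W j) * S) *
            p)‖ ≤ 2 * δ := by
          refine (norm_mul_le _ _).trans ?_
          rw [norm_star]
          exact mul_le_mul (hk i hi').2 (hδW _ (hW i hi') _ (hW j hj')) (norm_nonneg _)
            (by norm_num)
        calc _ ≤ 2 * δ * 2 := mul_le_mul a1 (hk j hj').2 (norm_nonneg _) (by positivity)
          _ = 4 * δ := by ring
      · simp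
    · simp; ring
  have h2 : ‖star yt * B * yt - star y * B * y‖ ≤ 4 * t ^ 2 * δ * (2 + 4 * t ^ 2 * δ) := by
    have hyt1 : ‖yt‖ ≤ 1 + 4 * t ^ 2 * δ := by
      have := norm_sub_le y (y - yt)
      rw [sub_sub_cancel] at this
      linarith
    have e : star yt * B * yt - star y * B * y =
        -(star yt * B * (y - yt)) - star (y - yt) * B * y := by
      rw [star_sub]; noncomm_ring
    rw [e]
    refine (norm_sub_le _ _).trans ?_
    rw [norm_neg]
    have a1 : ‖star yt * B * (y - yt)‖ ≤ (1 + 4 * t ^ 2 * δ) * 1 * (4 * t ^ 2 * δ) := by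
      refine (norm_mul_le _ _).trans (mul_le_mul ((norm_mul_le _ _).trans ?_) hy (norm_nonneg _)
        (by positivity))
      rw [norm_star]
      exact mul_le_mul hyt1 hB (norm_nonneg _) (by positivity)
    have a2 : ‖star (y - yt) * B * y‖ ≤ (4 * t ^ 2 * δ) * 1 * 1 := by
      refine (norm_mul_le _ _).trans (mul_le_mul ((norm_mul_le _ _).trans ?_) hy1 (norm_nonneg _)
        (by positivity))
      rw [norm_star]
      exact mul_le_mul hy hB (norm_nonneg _) (by positivity)
    linarith
  have : star x * B * x - star y * B * y =
      (star x * B * x - star yt * B * yt) + (star yt * B * yt - star y * B * y) := by abel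
  rw [this]
  exact (norm_add_le _ _).trans (add_le_add h1 h2)

end History

/-! ### Removing the condition on M' from one side of the compression -/

section Compression

variable {𝒜 : Type*} [CStarAlgebra 𝒜]

/-- If conjugation by the symmetry `s` maps `z` to `m`, and `W` commutes with `z`, then the difference
`W - s W s`, compressed to `P z` on the right and to `P` on the left, is controlled by its
compression to `P z` on both sides. -/
theorem norm_compression_le {s P z m W : 𝒜} {δ : ℝ} (hs : IsSelfAdjoint s) (hs2 : s * s = 1)
    (hz : IsStarProjection z) (hm : IsStarProjection m)
    (hsP : Commute s P) (hPz : Commute P z) (hmP : Commute m P) (hmz : Commute m z)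
    (hWz : Commute W z) (hsz : s * z = m * s) (hsmz : s * (m * z) = m * z)
    (hY : ‖(1 - m) * P * W * P * m‖ ≤ ‖(1 - m) * P * W * P * m * z‖)
    (hδ : ‖(P * z) * (W - s * W * s) * (P * z)‖ ≤ δ) :
    ‖P * (W - s * W * s) * (P * z)‖ ≤ 2 * δ := by
  have hzz := hz.isIdempotentElem.eq
  have hmm := hm.isIdempotentElem.eq
  have hzs : z * s = s * m := by
    calc z * s = s * s * (z * s) := by rw [hs2, one_mul]
      _ = s * (s * z) * s := by noncomm_ring
      _ = s * m * (s * s) := by rw [hsz]; noncomm_ring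
      _ = s * m := by rw [hs2, mul_one]
  have hsu : s ∈ unitary 𝒜 := by
    rw [Unitary.mem_iff, hs.star_eq]; exact ⟨hs2, hs2⟩
  set Y := (1 - m) * P * W * P * m with hYdef
  -- Only s W s can lead out of `z`, since `W` and `P` commute with it. Moving `s` outwards turns
  -- `z` into `m`, which leaves the off-diagonal block Y of W with respect to m.
  have hzT : (1 - z) * (P * (W - s * W * s) * (P * z)) = -(s * Y * s) := by
    have e1 : (1 - z) * (P * W * (P * z)) = 0 := by
      have : z * (P * W * (P * z)) = P * W * (P * z) := by
        calc _ = (z * P) * W * (P * z) := by noncomm_ring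
          _ = P * (z * W) * (P * z) := by rw [← hPz.eq]; noncomm_ring
          _ = P * W * (z * P) * z := by rw [← hWz.eq]; noncomm_ring
          _ = P * W * P * (z * z) := by rw [← hPz.eq]; noncomm_ring
          _ = _ := by rw [hzz]; noncomm_ring
      rw [sub_mul, one_mul, this, sub_self]
    have e2 : (1 - z) * (P * (s * W * s) * (P * z)) = s * Y * s := by
      have l : (1 - z) * P * s = s * (1 - m) * P := by
        calc (1 - z) * P * s = (1 - z) * (P * s) := by noncomm_ring
          _ = s * P - (z * s) * P := by rw [← hsP.eq]; noncomm_ring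
          _ = _ := by rw [hzs]; noncomm_ring
      have r : s * (P * z) = P * m * s := by
        rw [← mul_assoc, hsP.eq, mul_assoc, hsz, mul_assoc]
      calc _ = ((1 - z) * P * s) * W * (s * (P * z)) := by noncomm_ring
        _ = _ := by rw [l, r, hYdef]; noncomm_ring
    have : P * (W - s * W * s) * (P * z) = P * W * (P * z) - P * (s * W * s) * (P * z) := by
      noncomm_ring
    rw [this, mul_sub, e1, e2, zero_sub]
  -- On m z the symmetry `s` is trivial, so the term s W s contributes nothing between 1 − m and m,
  -- and the hypothesis on the two-sided compression bounds Y z.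
  have hYz : Y * z = (1 - m) * ((P * z) * (W - s * W * s) * (P * z)) * m := by
    have e1 : (1 - m) * ((P * z) * W * (P * z)) * m = Y * z := by
      calc _ = (1 - m) * P * (z * W) * P * (z * m) := by noncomm_ring
        _ = (1 - m) * P * W * (z * P) * m * z := by rw [← hWz.eq, ← hmz.eq]; noncomm_ring
        _ = (1 - m) * P * W * P * (z * m) * z := by rw [← hPz.eq]; noncomm_ring
        _ = (1 - m) * P * W * P * m * (z * z) := by rw [← hmz.eq]; noncomm_ring
        _ = _ := by rw [hzz]
    have e2 : (1 - m) * ((P * z) * (s * W * s) * (P * z)) * m = 0 := by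
      have a1 : s * (P * z) * m = z * P * m := by
        calc _ = (s * P) * (z * m) := by noncomm_ring
          _ = P * (s * (m * z)) := by rw [hsP.eq, ← hmz.eq]; noncomm_ring
          _ = P * (z * m) := by rw [hsmz, hmz.eq]
          _ = _ := by rw [← mul_assoc, hPz.eq]
      have a2 : z * s * z = m * z := by rw [hzs, mul_assoc, hsmz]
      have a3 : (1 - m) * P * m = 0 := by
        rw [mul_assoc, ← hmP.eq, ← mul_assoc, sub_mul, one_mul, hmm, sub_self, zero_mul]
      calc _ = (1 - m) * P * (z * s) * W * (s * (P * z) * m) := by noncomm_ring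
        _ = (1 - m) * P * (z * s) * (W * z) * P * m := by rw [a1]; noncomm_ring
        _ = (1 - m) * P * (z * s * z) * W * P * m := by rw [hWz.eq]; noncomm_ring
        _ = ((1 - m) * P * m) * z * W * P * m := by rw [a2]; noncomm_ring
        _ = 0 := by rw [a3]; simp
    have : (P * z) * (W - s * W * s) * (P * z) =
        (P * z) * W * (P * z) - (P * z) * (s * W * s) * (P * z) := by noncomm_ring
    rw [this, mul_sub, sub_mul, e1, e2, sub_zero]
  have hδ0 : 0 ≤ δ := (norm_nonneg _).trans hδ
  have hYδ : ‖Y‖ ≤ δ := by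
    refine hY.trans ?_
    rw [hYz]
    refine (norm_mul_le _ _).trans ?_
    have h1 : ‖(1 - m) * ((P * z) * (W - s * W * s) * (P * z))‖ ≤ 1 * δ :=
      (norm_mul_le _ _).trans (mul_le_mul hm.one_sub.norm_le hδ (norm_nonneg _) zero_le_one)
    calc _ ≤ (1 * δ) * 1 := mul_le_mul h1 hm.norm_le (norm_nonneg _) (by linarith)
      _ = δ := by ring
  have hsplit : P * (W - s * W * s) * (P * z) =
      (P * z) * (W - s * W * s) * (P * z) + -(s * Y * s) := by
    rw [← hzT, hPz.eq]
    noncomm_ring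
  rw [hsplit]
  refine (norm_add_le _ _).trans ?_
  rw [norm_neg, CStarRing.norm_mul_mem_unitary _ hsu, CStarRing.norm_mem_unitary_mul _ hsu]
  linarith

end Compression

/-! ### Norms of operators tensored with projections -/

section TensorNorm

variable {ι κ μ : Type} [Fintype ι] [DecidableEq ι] [Fintype κ] [DecidableEq κ]
  [Fintype μ] [DecidableEq μ]

/-- An injective star homomorphism of C⋆-algebras is isometric. -/
theorem norm_onQubits (e : κ ↪ ι) (X : QOp κ) : ‖onQubits e X‖ = ‖X‖ :=
  NonUnitalStarAlgHom.norm_map (onQubitsHom e) (onQubits_injective e) X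

theorem IsStarProjection.onQubits {q : QOp μ} (hq : IsStarProjection q) (f : μ ↪ ι) :
    IsStarProjection (onQubits f q) :=
  hq.map (onQubitsHom f)

/-- Tensoring with a nonzero projection, as a homomorphism. -/
def tensorProjHom (e : κ ↪ ι) (f : μ ↪ ι) (hd : Disjoint (Set.range e) (Set.range f)) {q : QOp μ}
    (hq : IsStarProjection q) : QOp κ →⋆ₙₐ[ℂ] QOp ι where
  toFun X := onQubits e X * onQubits f q
  map_smul' c X := by simp only [onQubits_smul, smul_mul_assoc]; rfl
  map_zero' := by rw [← onQubitsHom_apply, map_zero, zero_mul]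
  map_add' X Y := by rw [onQubits_add, add_mul]
  map_mul' X Y := by
    have h := (onQubits_commute e f hd Y q).eq
    have hqq := (hq.onQubits f).isIdempotentElem.eq
    rw [onQubits_mul, mul_assoc, h, mul_assoc (onQubits e X), ← mul_assoc (onQubits f q), hqq]
  map_star' X := by
    have h := (onQubits_commute e f hd (star X) q).eq
    have hqs := (hq.onQubits f).isSelfAdjoint.star_eq
    rw [star_mul, hqs, h, Matrix.star_eq_conjTranspose, onQubits_conjTranspose]
    rfl

/-- Again isometry of an injective star homomorphism, now non-unital. A nonzero diagonal entry of
`q` suffices for injectivity, since every entry of `X` appears multiplied by it. -/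
theorem norm_onQubits_mul_proj (e : κ ↪ ι) (f : μ ↪ ι)
    (hd : Disjoint (Set.range e) (Set.range f)) {q : QOp μ} (hq : IsStarProjection q)
    {b : μ → Bool} (hb : q b b ≠ 0) (X : QOp κ) : ‖onQubits e X * onQubits f q‖ = ‖X‖ := by
  refine NonUnitalStarAlgHom.norm_map (tensorProjHom e f hd hq) ?_ X
  rw [injective_iff_map_eq_zero]
  intro X hX
  classical
  ext a a'
  have hX' : onQubits e X * onQubits f q = 0 := hX
  set x : (κ → Bool) → ι → Bool := fun a =>
    Function.extend e a (Function.extend f b fun _ => false) with hx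
  have hxe : ∀ a, (fun k => x a (e k)) = a := fun a => funext fun k => e.injective.extend_apply _ _ _
  have hxf : ∀ a, (fun k => x a (f k)) = b := fun a => funext fun k => by
    rw [hx]
    dsimp only
    rw [Function.extend_apply' _ _ _ (fun h => Set.disjoint_left.1 hd h ⟨k, rfl⟩),
      f.injective.extend_apply]
  have := congrFun (congrFun hX' (x a)) (x a')
  rw [onQubits_mul_of_disjoint_apply e f hd, if_pos, hxe, hxe, hxf, hxf] at this
  · exact (mul_eq_zero.1 this).resolve_right hb
  · intro i hi _
    rw [hx]
    dsimp only
    rw [Function.extend_apply' _ _ _ hi, Function.extend_apply' _ _ _ hi]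

theorem isStarProjection_diagonal {p : (ι → Bool) → Prop} [DecidablePred p] :
    IsStarProjection (Matrix.diagonal fun x => if p x then 1 else 0 : QOp ι) := by
  constructor
  · rw [IsIdempotentElem, Matrix.diagonal_mul_diagonal]
    congr 1; funext x; split_ifs <;> simp
  · rw [IsSelfAdjoint, Matrix.star_eq_conjTranspose, Matrix.diagonal_conjTranspose]
    congr 1; funext x; simp only [Pi.star_apply]; split_ifs <;> simp

theorem isStarProjection_zeroProj : IsStarProjection (zeroProj ι) := isStarProjection_diagonal

theorem isStarProjection_bitProj (i : ι) (b : Bool) : IsStarProjection (bitProj i b) :=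
  isStarProjection_diagonal

theorem tensorOp_eq (A : QOp κ) (B : QOp μ) :
    tensorOp A B = onQubits Function.Embedding.inl A * onQubits Function.Embedding.inr B := by
  classical
  ext x y
  rw [onQubits_mul_of_disjoint_apply, if_pos]
  · rfl
  · rintro (i | i) h1 h2
    · exact absurd ⟨i, rfl⟩ h1
    · exact absurd ⟨i, rfl⟩ h2
  · rw [Set.disjoint_left]
    rintro _ ⟨i, rfl⟩ ⟨j, hj⟩
    cases hj

end TensorNorm

/-! ### The projections and the conjugated swap of a commitment scheme -/

namespace QSC

variable (S : QSC) {κ : ℕ} (r : ℕ)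

/-- `(C, D, R)` inside the whole system. -/
def embCDR : S.MW κ ⊕ Fin r ↪ S.Total κ r := Function.Embedding.inl

/-- `M'` inside the whole system. -/
def embFresh : Fin (S.n κ) ↪ S.Total κ r := Function.Embedding.inr

/-- `M` inside the whole system. -/
def embM : Fin (S.n κ) ↪ S.Total κ r := Function.Embedding.inl.trans (S.embSwap r)

/-- `|0⟩⟨0|` on `M'`. -/
def freshZero : QOp (S.Total κ r) := onQubits (S.embFresh r) (zeroProj (Fin (S.n κ)))

/-- The projection onto the commitments to `|0⟩`. -/
def zeroCom : QOp (S.Total κ r) := S.hat r (onQubits (S.embM r) (zeroProj (Fin (S.n κ))))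

/-- `SWAP[M, M']`, conjugated by `Com`. -/
def swapHat : QOp (S.Total κ r) := S.hat r (S.swapMM r)

theorem comT_mem_unitary : S.comT r ∈ unitary (QOp (S.Total κ r)) :=
  onQubits_mem_unitary _ (S.Com κ).2

/-- Conjugation by `Com`. -/
def hatHom : QOp (S.Total κ r) →⋆ₐ[ℂ] QOp (S.Total κ r) :=
  (Unitary.conjStarAlgAut ℂ (QOp (S.Total κ r)) ⟨S.comT r, S.comT_mem_unitary r⟩ :
    QOp (S.Total κ r) →⋆ₐ[ℂ] QOp (S.Total κ r))

theorem hatHom_apply (A : QOp (S.Total κ r)) : S.hatHom r A = S.hat r A := rfl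

theorem hat_eq_of_commute {A : QOp (S.Total κ r)} (h : Commute (S.comT r) A) : S.hat r A = A := by
  have h1 : S.comT (κ := κ) r * (S.comT r).conjTranspose = 1 :=
    Unitary.mul_star_self_of_mem (S.comT_mem_unitary r)
  rw [hat, h.eq, mul_assoc, h1, mul_one]

theorem freshZero_commute_of_disjoint {μ : Type} [Fintype μ] [DecidableEq μ] (e : μ ↪ S.Total κ r)
    (he : ∀ i, ∃ q, e i = Sum.inl q) (A : QOp μ) :
    Commute (onQubits e A) (S.freshZero r) := by
  refine onQubits_commute _ _ ?_ _ _
  rw [Set.disjoint_left]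
  rintro _ ⟨i, rfl⟩ ⟨j, hj⟩
  obtain ⟨q, hq⟩ := he i
  rw [hq] at hj
  cases hj

theorem hat_freshZero : S.hat r (S.freshZero (κ := κ) r) = S.freshZero r :=
  S.hat_eq_of_commute r (S.freshZero_commute_of_disjoint r _ (fun _ => ⟨_, rfl⟩) _)

theorem swapOp_eq (n : ℕ) : swapOp n = permOp fun x => x ∘ Sum.swap := rfl

theorem involutive_comp_swap (n : ℕ) :
    Function.Involutive fun x : Fin n ⊕ Fin n → Bool => x ∘ Sum.swap := fun x => by
  funext i
  simp

theorem swapHat_isSelfAdjoint : IsSelfAdjoint (S.swapHat (κ := κ) r) := by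
  have : IsSelfAdjoint (swapOp (S.n κ)) := permOp_conjTranspose (involutive_comp_swap _)
  exact (this.map (onQubitsHom (S.embSwap r))).map (S.hatHom r)

theorem swapHat_mul_self : S.swapHat (κ := κ) r * S.swapHat r = 1 := by
  rw [swapHat, ← hatHom_apply, ← map_mul, swapMM, ← onQubits_mul, swapOp_eq,
    permOp_mul_self (involutive_comp_swap _), onQubits_one, map_one]

theorem isStarProjection_zeroW : IsStarProjection (S.zeroW (κ := κ) r) :=
  isStarProjection_zeroProj.onQubits _

theorem isStarProjection_validProj : IsStarProjection (S.validProj (κ := κ) r) :=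
  (S.isStarProjection_zeroW r).map (S.hatHom r)

theorem isStarProjection_freshZero : IsStarProjection (S.freshZero (κ := κ) r) :=
  isStarProjection_zeroProj.onQubits _

theorem isStarProjection_zeroCom : IsStarProjection (S.zeroCom (κ := κ) r) :=
  (isStarProjection_zeroProj.onQubits _).map (S.hatHom r)

theorem swapHat_commute_validProj : Commute (S.swapHat (κ := κ) r) (S.validProj r) := by
  have h : Commute (S.swapMM (κ := κ) r) (S.zeroW r) := by
    refine onQubits_commute _ _ ?_ _ _
    rw [Set.disjoint_left]
    rintro _ ⟨i | i, rfl⟩ ⟨j, hj⟩ <;> cases hj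
  exact h.map (S.hatHom r)

theorem validProj_commute_freshZero : Commute (S.validProj (κ := κ) r) (S.freshZero r) := by
  have h : Commute (S.zeroW (κ := κ) r) (S.freshZero r) :=
    S.freshZero_commute_of_disjoint r _ (fun _ => ⟨_, rfl⟩) _
  have := h.map (S.hatHom r)
  rwa [hatHom_apply, hatHom_apply, hat_freshZero] at this

theorem zeroCom_commute_validProj : Commute (S.zeroCom (κ := κ) r) (S.validProj r) := by
  have h : Commute (onQubits (S.embM r) (zeroProj (Fin (S.n κ)))) (S.zeroW (κ := κ) r) := by
    refine onQubits_commute _ _ ?_ _ _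
    rw [Set.disjoint_left]
    rintro _ ⟨i, rfl⟩ ⟨j, hj⟩
    cases hj
  exact h.map (S.hatHom r)

theorem zeroCom_commute_freshZero : Commute (S.zeroCom (κ := κ) r) (S.freshZero r) := by
  have h : Commute (onQubits (S.embM r) (zeroProj (Fin (S.n κ)))) (S.freshZero (κ := κ) r) :=
    S.freshZero_commute_of_disjoint r _ (fun _ => ⟨_, rfl⟩) _
  have := h.map (S.hatHom r)
  rwa [hatHom_apply, hatHom_apply, hat_freshZero] at this

theorem freshZero_eq : S.freshZero (κ := κ) r =
    onQubits (S.embSwap r) (onQubits Function.Embedding.inr (zeroProj (Fin (S.n κ)))) := by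
  rw [← onQubits_trans]
  rfl

theorem onQubits_embM : onQubits (S.embM (κ := κ) r) (zeroProj (Fin (S.n κ))) =
    onQubits (S.embSwap r) (onQubits Function.Embedding.inl (zeroProj (Fin (S.n κ)))) :=
  onQubits_trans _ _ _

/-- The swap carries the condition M' = 0 to the condition M = 0. -/
theorem swapHat_mul_freshZero :
    S.swapHat (κ := κ) r * S.freshZero r = S.zeroCom r * S.swapHat r := by
  rw [← hat_freshZero, swapHat, zeroCom, ← hatHom_apply, ← hatHom_apply, ← hatHom_apply, ← map_mul,
    ← map_mul, swapMM, freshZero_eq, onQubits_embM, ← onQubits_mul, ← onQubits_mul, zeroProj,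
    onQubits_diagonal, onQubits_diagonal, swapOp_eq, permOp_mul_diagonal (involutive_comp_swap _)]
  rfl

/-- With M and M' both zero there is nothing to exchange. -/
theorem swapHat_mul_zeroCom_mul_freshZero :
    S.swapHat (κ := κ) r * (S.zeroCom r * S.freshZero r) = S.zeroCom r * S.freshZero r := by
  rw [← hat_freshZero, swapHat, zeroCom, ← hatHom_apply, ← hatHom_apply, ← hatHom_apply, ← map_mul,
    ← map_mul, swapMM, freshZero_eq, onQubits_embM, ← onQubits_mul, ← onQubits_mul, zeroProj,
    onQubits_diagonal, onQubits_diagonal, Matrix.diagonal_mul_diagonal, swapOp_eq]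
  congr 2
  ext x y
  rw [permOp_mul_apply (involutive_comp_swap _), Matrix.diagonal_apply, Matrix.diagonal_apply]
  have h0 : ∀ u : Fin (S.n κ) ⊕ Fin (S.n κ) → Bool,
      ((if (fun k => u (Function.Embedding.inl k)) = (fun _ => false) then (1 : ℂ) else 0) *
        if (fun k => u (Function.Embedding.inr k)) = (fun _ => false) then 1 else 0) =
      if u = (fun _ => false) then 1 else 0 := by
    intro u
    rw [ite_zero_mul_ite_zero, mul_one]
    congr 1
    refine propext ⟨fun ⟨h1, h2⟩ => ?_, fun h => by rw [h]; exact ⟨rfl, rfl⟩⟩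
    funext i
    rcases i with i | i
    exacts [congrFun h1 i, congrFun h2 i]
  rw [h0, h0]
  have h1 : x ∘ Sum.swap = (fun _ => false) ↔ x = fun _ => false :=
    ⟨fun h => by rw [← involutive_comp_swap _ x]; dsimp only; rw [h]; rfl, fun h => by rw [h]; rfl⟩
  by_cases hx : x = fun _ => false
  · subst hx; rfl
  · rw [if_neg hx, if_neg (mt h1.1 hx), ite_self, ite_self]

/-- A unitary of the adversary on `(D, R)`. -/
def advOp (U : QOp (S.DReg κ ⊕ Fin r)) : QOp (S.Total κ r) := onQubits (S.embDR r) U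

theorem advOp_commute_freshZero (U : QOp (S.DReg κ ⊕ Fin r)) :
    Commute (S.advOp r U) (S.freshZero r) :=
  S.freshZero_commute_of_disjoint r _ (by rintro (i | i) <;> exact ⟨_, rfl⟩) _

theorem hat_onQubits_embMR_commute_validProj (O : QOp (Fin (S.n κ) ⊕ Fin r)) :
    Commute (S.hat r (onQubits (S.embMR r) O)) (S.validProj r) := by
  have h : Commute (onQubits (S.embMR r) O) (S.zeroW (κ := κ) r) := by
    refine onQubits_commute _ _ ?_ _ _
    rw [Set.disjoint_left]
    rintro _ ⟨i | i, rfl⟩ ⟨j, hj⟩ <;> cases hj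
  exact h.map (S.hatHom r)

theorem hat_onQubits_embMR_commute_freshZero (O : QOp (Fin (S.n κ) ⊕ Fin r)) :
    Commute (S.hat r (onQubits (S.embMR r) O)) (S.freshZero r) := by
  have h : Commute (onQubits (S.embMR r) O) (S.freshZero (κ := κ) r) :=
    S.freshZero_commute_of_disjoint r _ (by rintro (i | i) <;> exact ⟨_, rfl⟩) _
  have := h.map (S.hatHom r)
  rwa [hatHom_apply, hatHom_apply, hat_freshZero] at this

theorem hat_mem_unitary {A : QOp (S.Total κ r)} (hA : A ∈ QUnitary (S.Total κ r)) :
    S.hat r A ∈ unitary (QOp (S.Total κ r)) :=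
  Unitary.map_mem (S.hatHom r) hA

/-- The subalgebra here consists of the operators that do not touch M'. Membership is what makes
`norm_mul_freshZero` applicable. -/
theorem comT_mem_range : S.comT (κ := κ) r ∈ (onQubitsHom (S.embCDR (κ := κ) r)).range :=
  ⟨onQubits Function.Embedding.inl (S.Com κ).1, (onQubits_trans _ _ _).symm⟩

theorem hat_mem_range {A : QOp (S.Total κ r)}
    (hA : A ∈ (onQubitsHom (S.embCDR (κ := κ) r)).range) :
    S.hat r A ∈ (onQubitsHom (S.embCDR (κ := κ) r)).range :=
  mul_mem (mul_mem (S.comT_mem_range r) hA) (star_mem (S.comT_mem_range r))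

theorem validProj_mem_range : S.validProj (κ := κ) r ∈ (onQubitsHom (S.embCDR (κ := κ) r)).range :=
  S.hat_mem_range r ⟨onQubits (Function.Embedding.inr.trans Function.Embedding.inl)
    (zeroProj (Fin κ)), (onQubits_trans _ _ _).symm⟩

theorem zeroCom_mem_range : S.zeroCom (κ := κ) r ∈ (onQubitsHom (S.embCDR (κ := κ) r)).range :=
  S.hat_mem_range r ⟨onQubits (Function.Embedding.inl.trans Function.Embedding.inl)
    (zeroProj (Fin (S.n κ))), (onQubits_trans _ _ _).symm⟩

theorem advOp_mem_range (U : QOp (S.DReg κ ⊕ Fin r)) :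
    S.advOp r U ∈ (onQubitsHom (S.embCDR (κ := κ) r)).range := by
  refine ⟨onQubits ⟨Sum.map Subtype.val id, Subtype.val_injective.sumMap Function.injective_id⟩ U,
    ?_⟩
  change onQubits _ (onQubits _ _) = _
  rw [← onQubits_trans, advOp]
  congr 1
  ext i
  rcases i with i | i <;> rfl

theorem disjoint_embCDR_embFresh :
    Disjoint (Set.range (S.embCDR (κ := κ) r)) (Set.range (S.embFresh (κ := κ) r)) := by
  rw [Set.disjoint_left]
  rintro _ ⟨i, rfl⟩ ⟨j, hj⟩
  cases hj

theorem norm_mul_freshZero {Y : QOp (S.Total κ r)}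
    (hY : Y ∈ (onQubitsHom (S.embCDR (κ := κ) r)).range) : ‖Y * S.freshZero r‖ = ‖Y‖ := by
  obtain ⟨X, rfl⟩ := hY
  have h := norm_onQubits_mul_proj (S.embCDR r) (S.embFresh r) (S.disjoint_embCDR_embFresh r)
    (isStarProjection_zeroProj) (b := fun _ => false) (by simp [zeroProj]) X
  exact h.trans (norm_onQubits _ _).symm

/-- The projection onto the valid states of `(C, D)` with `M'` zero. -/
def startProj : QOp (S.Total κ r) := S.validProj r * S.freshZero r

theorem isStarProjection_startProj : IsStarProjection (S.startProj (κ := κ) r) :=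
  (S.isStarProjection_validProj r).mul (S.isStarProjection_freshZero r)
    (S.validProj_commute_freshZero r)

/-- The instance of `norm_compression_le` with `m` the projection onto commitments to zero. The
block to be bounded acts on (C, D, R) only, so projecting onto M' = 0 preserves its norm. -/
theorem norm_validProj_mul_le {U : QOp (S.DReg κ ⊕ Fin r)} {δ : ℝ}
    (hδ : ‖S.startProj r * (S.advOp r U - S.swapHat r * S.advOp r U * S.swapHat r) *
      S.startProj r‖ ≤ δ) :
    ‖S.validProj r * (S.advOp r U - S.swapHat r * S.advOp r U * S.swapHat r) *
      S.startProj r‖ ≤ 2 * δ := by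
  refine norm_compression_le (S.swapHat_isSelfAdjoint r) (S.swapHat_mul_self r)
    (S.isStarProjection_freshZero r) (S.isStarProjection_zeroCom r)
    (S.swapHat_commute_validProj r) (S.validProj_commute_freshZero r)
    (S.zeroCom_commute_validProj r) (S.zeroCom_commute_freshZero r)
    (S.advOp_commute_freshZero r U) (S.swapHat_mul_freshZero r)
    (S.swapHat_mul_zeroCom_mul_freshZero r) (S.norm_mul_freshZero r ?_).ge hδ
  have hP := S.validProj_mem_range (κ := κ) r
  have hm := S.zeroCom_mem_range (κ := κ) r
  exact mul_mem (mul_mem (mul_mem (mul_mem (sub_mem (one_mem _) hm) hP) (S.advOp_mem_range r U)) hP)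
    hm

end QSC

/-! ### Operator norms and expectations -/

section Trace

variable {n : Type} [Fintype n] [DecidableEq n]

/-- With ρ = D†D, the trace of D (‖M‖ − M) D† is nonnegative. -/
theorem trace_re_mul_le_of_posSemidef {ρ : Matrix n n ℂ} (hρ : ρ.PosSemidef) (hρ1 : ρ.trace = 1)
    {M : Matrix n n ℂ} (hM : M.IsHermitian) : (ρ * M).trace.re ≤ ‖M‖ := by
  obtain ⟨D, hD⟩ : ∃ D : Matrix n n ℂ, ρ = D.conjTranspose * D := by
    open scoped MatrixOrder in
    exact CStarAlgebra.nonneg_iff_eq_star_mul_self.1 (Matrix.nonneg_iff_posSemidef.2 hρ)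
  have h1 : ((‖M‖ : ℂ) • (1 : Matrix n n ℂ) - M).PosSemidef := by
    open scoped MatrixOrder in
    have h := IsSelfAdjoint.le_algebraMap_norm_self (a := M) hM
    rw [Matrix.le_iff, Algebra.algebraMap_eq_smul_one, ← Complex.coe_smul] at h
    exact h
  have h2 := (h1.mul_mul_conjTranspose_same D).trace_nonneg
  have h3 : (D * ((‖M‖ : ℂ) • (1 : Matrix n n ℂ) - M) * D.conjTranspose).trace =
      (‖M‖ : ℂ) - (ρ * M).trace := by
    rw [Matrix.trace_mul_comm, ← mul_assoc, ← hD, mul_sub, Matrix.trace_sub, mul_smul_comm, mul_one,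
      Matrix.trace_smul, hρ1, smul_eq_mul, mul_one]
  rw [h3] at h2
  have := (Complex.le_def.1 h2).1
  simpa using this

/-- It suffices to test on the eigenprojections of `Q`, whose expectations are the eigenvalues. -/
theorem norm_le_of_forall_trace_re_le {Q : Matrix n n ℂ} (hQ : Q.IsHermitian) {c : ℝ} (hc : 0 ≤ c)
    (h : ∀ ρ : Matrix n n ℂ, ρ.PosSemidef → ρ.trace = 1 → |(ρ * Q).trace.re| ≤ c) : ‖Q‖ ≤ c := by
  have hspec := hQ.spectral_theorem
  rw [Unitary.conjStarAlgAut_apply] at hspec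
  set U := hQ.eigenvectorUnitary
  have hU : U.1.conjTranspose * U.1 = 1 := Unitary.coe_star_mul_self U
  rw [hspec]
  change ‖U.1 * _ * (star U).1‖ ≤ c
  rw [CStarRing.norm_mul_mem_unitary _ (star U).2, CStarRing.norm_mem_unitary_mul _ U.2,
    Matrix.l2_opNorm_diagonal, pi_norm_le_iff_of_nonneg hc]
  intro a
  have hE : (Matrix.single a a (1 : ℂ)).PosSemidef := by
    rw [← Matrix.diagonal_single]
    refine Matrix.PosSemidef.diagonal fun b => ?_
    by_cases hb : b = a
    · subst hb; simp
    · simp [Pi.single_eq_of_ne hb]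
  have h1 := h (U.1 * Matrix.single a a 1 * U.1.conjTranspose) (hE.mul_mul_conjTranspose_same _)
    (by rw [Matrix.trace_mul_comm, ← mul_assoc, hU, one_mul, Matrix.trace_single_eq_same])
  have h2 : (U.1 * Matrix.single a a 1 * U.1.conjTranspose * Q).trace =
      (hQ.eigenvalues a : ℂ) := by
    have : U.1.conjTranspose * Q * U.1 =
        Matrix.diagonal fun a => (hQ.eigenvalues a : ℂ) := by
      conv_lhs => rw [hspec]
      change U.1.conjTranspose * (U.1 * Matrix.diagonal _ * U.1.conjTranspose) * U.1 = _
      calc _ = (U.1.conjTranspose * U.1) * Matrix.diagonal _ * (U.1.conjTranspose * U.1) := by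
            noncomm_ring
        _ = _ := by rw [hU, one_mul, mul_one]; rfl
    rw [mul_assoc, mul_assoc, Matrix.trace_mul_comm, mul_assoc, this]
    simp only [Matrix.trace, Matrix.diag, Matrix.mul_diagonal]
    rw [Finset.sum_eq_single a]
    · simp
    · intro i _ hi
      simp [hi.symm]
    · simp
  rw [h2, Complex.ofReal_re] at h1
  simpa using h1

end Trace

/-! ### Adjoining a register in the state zero -/

section Ket

variable {ι κ : Type} [Fintype ι] [DecidableEq ι] [Fintype κ] [DecidableEq κ]

/-- The isometry adjoining the register `κ` in the state zero. -/
def zeroKet (ι κ : Type) [Fintype ι] [DecidableEq ι] [Fintype κ] [DecidableEq κ] :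
    Matrix (ι ⊕ κ → Bool) (ι → Bool) ℂ :=
  Matrix.of fun x a => if x = Sum.elim a (fun _ => false) then 1 else 0

theorem zeroKet_conjTranspose_mul_self : (zeroKet ι κ).conjTranspose * zeroKet ι κ = 1 := by
  ext a b
  rw [Matrix.mul_apply, Finset.sum_eq_single (Sum.elim a fun _ => false)]
  · simp only [Matrix.conjTranspose_apply, zeroKet, Matrix.of_apply, if_true, star_one, one_mul,
      Matrix.one_apply]
    congr 1
    refine propext ⟨fun h => ?_, fun h => by rw [h]⟩
    funext i
    exact congrFun h (Sum.inl i)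
  · intro x _ hx
    simp [zeroKet, hx]
  · simp

theorem tensorOp_zeroProj_eq (ρ : QOp ι) :
    tensorOp ρ (zeroProj κ) = zeroKet ι κ * ρ * (zeroKet ι κ).conjTranspose := by
  have aux : ∀ (x : ι ⊕ κ → Bool) (a : ι → Bool), x = Sum.elim a (fun _ => false) ↔
      (fun i => x (Sum.inl i)) = a ∧ (fun k => x (Sum.inr k)) = fun _ => false := by
    refine fun x a => ⟨fun h => by subst h; exact ⟨rfl, rfl⟩, fun ⟨h1, h2⟩ => ?_⟩
    funext i
    rcases i with i | i
    exacts [congrFun h1 i, congrFun h2 i]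
  ext x y
  rw [Matrix.mul_apply, Finset.sum_eq_single fun i => y (Sum.inl i)]
  · rw [Matrix.mul_apply, Finset.sum_eq_single fun i => x (Sum.inl i)]
    · simp only [zeroKet, tensorOp, zeroProj, Matrix.of_apply, Matrix.conjTranspose_apply, aux,
        Matrix.diagonal_apply]
      by_cases hx : (fun k => x (Sum.inr k)) = fun _ => false
      · by_cases hy : (fun k => y (Sum.inr k)) = fun _ => false
        · simp [hx, hy]
        · have : ¬ (fun _ : κ => false) = fun k => y (Sum.inr k) := fun h => hy h.symm
          simp [hx, hy, this]
      · simp [hx]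
    · intro a _ ha
      simp only [zeroKet, Matrix.of_apply]
      rw [if_neg, zero_mul]
      exact fun h => ha ((aux x a).1 h).1.symm
    · simp
  · intro b _ hb
    simp only [zeroKet, Matrix.of_apply, Matrix.conjTranspose_apply]
    rw [if_neg, star_zero, mul_zero]
    exact fun h => hb ((aux y b).1 h).1.symm
  · simp

theorem IsDensity.tensorOp_zeroProj {ρ : QOp ι} (hρ : IsDensity ρ) :
    IsDensity (tensorOp ρ (zeroProj κ)) := by
  rw [tensorOp_zeroProj_eq]
  refine ⟨hρ.1.mul_mul_conjTranspose_same _, ?_⟩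
  rw [Matrix.trace_mul_comm, ← Matrix.mul_assoc, zeroKet_conjTranspose_mul_self, Matrix.one_mul,
    hρ.2]

/-- A Hermitian operator on the states with the register `κ` in the state zero is bounded by its
expectations. -/
theorem norm_le_of_forall_tensorOp_trace_re_le {Q : QOp (ι ⊕ κ)} (hQ : Q.IsHermitian)
    (hQz : tensorOp 1 (zeroProj κ) * Q * tensorOp 1 (zeroProj κ) = Q) {c : ℝ} (hc : 0 ≤ c)
    (h : ∀ ρ : QOp ι, IsDensity ρ → |(tensorOp ρ (zeroProj κ) * Q).trace.re| ≤ c) : ‖Q‖ ≤ c := by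
  set J := zeroKet ι κ with hJ
  have hJ1 : J.conjTranspose * J = 1 := zeroKet_conjTranspose_mul_self
  have hz : tensorOp (1 : QOp ι) (zeroProj κ) = J * J.conjTranspose := by
    rw [tensorOp_zeroProj_eq, Matrix.mul_one]
  have hJn : ‖J‖ ≤ 1 := by
    have h1 := Matrix.l2_opNorm_conjTranspose_mul_self J
    have h2 : ‖(1 : QOp ι)‖ = 1 := CStarRing.norm_one
    rw [hJ1, h2] at h1
    nlinarith [norm_nonneg J]
  set Q' : QOp ι := J.conjTranspose * Q * J with hQ'
  have hQ'c : ‖Q'‖ ≤ c := by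
    refine norm_le_of_forall_trace_re_le ?_ hc fun ρ hρ hρ1 => ?_
    · have := Matrix.isHermitian_conjTranspose_mul_mul J hQ
      exact this
    · have := h ρ ⟨hρ, hρ1⟩
      rw [tensorOp_zeroProj_eq] at this
      have e : (ρ * Q').trace = (J * ρ * J.conjTranspose * Q).trace := by
        rw [hQ', ← Matrix.mul_assoc, Matrix.trace_mul_comm]
        simp only [Matrix.mul_assoc]
      rwa [e]
  have hQeq : Q = J * Q' * J.conjTranspose := by
    rw [← hQz, hz, hQ']
    simp only [Matrix.mul_assoc]
  rw [hQeq]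
  refine (Matrix.l2_opNorm_mul _ _).trans ?_
  rw [Matrix.l2_opNorm_conjTranspose]
  have h1 : ‖J * Q'‖ ≤ 1 * c :=
    (Matrix.l2_opNorm_mul _ _).trans (mul_le_mul hJn hQ'c (norm_nonneg _) zero_le_one)
  calc _ ≤ (1 * c) * 1 := mul_le_mul h1 hJn (norm_nonneg _) (by linarith)
    _ = c := by ring

end Ket

/-- The Pauli `Z` observable of the qubit `i`. -/
def pauliZ {ι : Type} [Fintype ι] [DecidableEq ι] (i : ι) : QOp ι :=
  bitProj i false - bitProj i true

/-! ### Winning probabilities as expectations of observables -/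

namespace QSC

variable (S : QSC) {κ : ℕ} (r : ℕ)

theorem tensorOp_mul_freshZero (ρ : QOp (S.MW κ ⊕ Fin r)) :
    S.freshZero r * tensorOp ρ (zeroProj (Fin (S.n κ))) * S.freshZero r =
      tensorOp ρ (zeroProj (Fin (S.n κ))) := by
  have hz : tensorOp ρ (zeroProj (Fin (S.n κ))) = onQubits (S.embCDR r) ρ * S.freshZero r :=
    tensorOp_eq _ _
  have hi := (S.isStarProjection_freshZero (κ := κ) r).isIdempotentElem.eq
  have hc : Commute (onQubits (S.embCDR r) ρ) (S.freshZero r) :=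
    S.freshZero_commute_of_disjoint r _ (fun _ => ⟨_, rfl⟩) _
  rw [hz, mul_assoc, mul_assoc, hi, ← mul_assoc, ← hc.eq, mul_assoc, hi]

/-- All the challenger's actions collapse to one operator, s^b p. The factor `freshZero` in
`startProj` can be inserted because M' starts in the state zero. -/
theorem challengeState_eq (b : Bool) (ρ : QOp (S.MW κ ⊕ Fin r)) :
    S.challengeState r b ρ = (S.swapHat r ^ b.toNat * S.startProj r) *
      tensorOp ρ (zeroProj (Fin (S.n κ))) *
      (S.swapHat r ^ b.toNat * S.startProj r).conjTranspose := by
  have hA : S.comT r * S.swapMM r ^ b.toNat * S.zeroW r * (S.comT r).conjTranspose =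
      S.swapHat (κ := κ) r ^ b.toNat * S.validProj r := by
    rw [swapHat, validProj, ← hatHom_apply, ← hatHom_apply, ← map_pow, ← map_mul, hatHom_apply, hat]
    noncomm_ring
  have hw : (S.zeroW (κ := κ) r).conjTranspose = S.zeroW r :=
    (S.isStarProjection_zeroW r).isSelfAdjoint.star_eq
  have hz : (S.freshZero (κ := κ) r).conjTranspose = S.freshZero r :=
    (S.isStarProjection_freshZero r).isSelfAdjoint.star_eq
  have h1 : S.challengeState r b ρ =
      (S.comT r * S.swapMM r ^ b.toNat * S.zeroW r * (S.comT r).conjTranspose) *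
      tensorOp ρ (zeroProj (Fin (S.n κ))) *
      (S.comT r * S.swapMM r ^ b.toNat * S.zeroW r *
        (S.comT r).conjTranspose).conjTranspose := by
    simp only [challengeState, Matrix.conjTranspose_mul, Matrix.conjTranspose_conjTranspose, hw,
      mul_assoc]
  rw [h1, hA, startProj]
  conv_lhs => rw [← S.tensorOp_mul_freshZero]
  simp only [Matrix.conjTranspose_mul, hz, mul_assoc]

/-- The projector onto an outcome is (1 ± Z)/2. Its constant part combines with the coin tossed on
abort to exactly 1/2, whatever the probability of an abort. -/
theorem outputProb_eq (b b' : Bool) (ρ : QOp (S.MW κ ⊕ Fin r)) {V : QOp (S.Total κ r)}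
    (hV : V ∈ QUnitary (S.Total κ r)) (out : Fin r) :
    S.outputProb r b b' ρ V out = 1 / 2 + (bif b' then -1 else 1) / 2 *
      (tensorOp ρ (zeroProj (Fin (S.n κ))) *
        (star (V * (S.swapHat r ^ b.toNat * S.startProj r)) * pauliZ (Sum.inl (Sum.inr out)) *
          (V * (S.swapHat r ^ b.toNat * S.startProj r)))).trace.re := by
  set σ := S.challengeState r b ρ with hσ
  have hV' : V.conjTranspose * V = 1 := Unitary.star_mul_self_of_mem hV
  have h1 : (V * σ * V.conjTranspose).trace = σ.trace := by
    rw [Matrix.trace_mul_comm, ← mul_assoc, hV', one_mul]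
  have h2 : (pauliZ (Sum.inl (Sum.inr out)) * (V * σ * V.conjTranspose)).trace =
      (tensorOp ρ (zeroProj (Fin (S.n κ))) *
        (star (V * (S.swapHat r ^ b.toNat * S.startProj r)) * pauliZ (Sum.inl (Sum.inr out)) *
          (V * (S.swapHat r ^ b.toNat * S.startProj r)))).trace := by
    rw [hσ, challengeState_eq, Matrix.star_eq_conjTranspose]
    set A := S.swapHat r ^ b.toNat * S.startProj r
    set τ := tensorOp ρ (zeroProj (Fin (S.n κ)))
    set Z : QOp (S.Total κ r) := pauliZ (Sum.inl (Sum.inr out))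
    calc _ = ((Z * V * A) * (τ * (A.conjTranspose * V.conjTranspose))).trace := by
          simp only [mul_assoc]
      _ = _ := by
          rw [Matrix.trace_mul_comm, Matrix.conjTranspose_mul V A]
          simp only [mul_assoc]
  have h3 : ∀ X : QOp (S.Total κ r), (bitProj (Sum.inl (Sum.inr out)) b' * X).trace.re =
      X.trace.re / 2 + (bif b' then -1 else 1) / 2 *
        (pauliZ (Sum.inl (Sum.inr out)) * X).trace.re := by
    intro X
    have e : X.trace.re = (bitProj (Sum.inl (Sum.inr out)) false * X).trace.re +
        (bitProj (Sum.inl (Sum.inr out)) true * X).trace.re := by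
      rw [← Complex.add_re, ← Matrix.trace_add, ← add_mul, bitProj_add, one_mul]
    rw [pauliZ, sub_mul, Matrix.trace_sub, Complex.sub_re, e]
    cases b' <;> simp <;> ring
  rw [outputProb, h3, h1, ← h2]
  ring

theorem sum_outputProb_eq (ρ : QOp (S.MW κ ⊕ Fin r)) {V : Bool → QOp (S.Total κ r)}
    (hV : ∀ b, V b ∈ QUnitary (S.Total κ r)) (out : Fin r) :
    (∑ b : Bool, S.outputProb r b b ρ (V b) out) / 2 = 1 / 2 + 1 / 4 *
      (tensorOp ρ (zeroProj (Fin (S.n κ))) *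
        (star (V false * S.startProj r) * pauliZ (Sum.inl (Sum.inr out)) *
          (V false * S.startProj r) -
        star (V true * (S.swapHat r * S.startProj r)) * pauliZ (Sum.inl (Sum.inr out)) *
          (V true * (S.swapHat r * S.startProj r)))).trace.re := by
  rw [Fintype.sum_bool, S.outputProb_eq r _ _ _ (hV _), S.outputProb_eq r _ _ _ (hV _), mul_sub,
    Matrix.trace_sub, Complex.sub_re]
  simp only [Bool.toNat_true, Bool.toNat_false, pow_one, pow_zero, one_mul, cond_true, cond_false]
  ring

end QSC

/-! ### One-qubit gates of the Hadamard test -/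

section Hadamard

/-- The one-qubit unitary with rows `(1, s)` and `(1, -s)`, up to normalization. -/
def hadamard (s : ℂ) : QOp (Fin 1) :=
  Matrix.of fun x y => (Real.sqrt 2 : ℂ)⁻¹ *
    (bif y 0 then (bif x 0 then -s else s) else 1)

/-- The Pauli `X` operator of one qubit. -/
def pauliX : QOp (Fin 1) := permOp fun x i => !(x i)

theorem involutive_not : Function.Involutive fun (x : Fin 1 → Bool) i => !(x i) := fun x => by
  funext i
  simp

theorem sum_bits_one (f : (Fin 1 → Bool) → ℂ) :
    ∑ x, f x = f (fun _ => false) + f (fun _ => true) := by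
  rw [← (Equiv.funUnique (Fin 1) Bool).symm.sum_comp, Fintype.sum_bool, add_comm]
  rfl

/-- Used twice: d = 1 gives unitarity, and d = ±1 shows that Z is conjugated to a multiple of X. -/
theorem hadamard_conj (s : ℂ) (d : Bool → ℂ) :
    (hadamard s).conjTranspose * Matrix.diagonal (fun x : Fin 1 → Bool => d (x 0)) * hadamard s =
      Matrix.of fun x y => (bif x 0 then star s else 1) * (bif y 0 then s else 1) *
        (d false + (bif xor (x 0) (y 0) then -1 else 1) * d true) / 2 := by
  have h2 : ((Real.sqrt 2 : ℂ)⁻¹) * (Real.sqrt 2 : ℂ)⁻¹ = 1 / 2 := by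
    rw [← mul_inv, ← Complex.ofReal_mul, Real.mul_self_sqrt (by norm_num)]
    norm_num
  ext x y
  rw [Matrix.mul_apply, sum_bits_one]
  simp only [Matrix.mul_diagonal, Matrix.conjTranspose_apply, hadamard, Matrix.of_apply]
  have hr : star ((Real.sqrt 2 : ℂ)⁻¹) = (Real.sqrt 2 : ℂ)⁻¹ := by
    rw [star_inv₀]
    congr 1
    exact Complex.conj_ofReal _
  cases x 0 <;> cases y 0 <;> simp only [cond_true, cond_false, star_mul, star_neg, hr,
    Bool.xor_false, Bool.xor_true, Bool.not_true, Bool.not_false, mul_one, one_mul]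
  · linear_combination (d false + d true) * h2
  · linear_combination (s * (d false - d true)) * h2
  · linear_combination (star s * (d false - d true)) * h2
  · linear_combination (star s * s * (d false + d true)) * h2

theorem hadamard_mem_unitary {s : ℂ} (hs : star s * s = 1) : hadamard s ∈ QUnitary (Fin 1) := by
  rw [Matrix.mem_unitaryGroup_iff', Matrix.star_eq_conjTranspose]
  have h := hadamard_conj s fun _ => 1
  rw [Matrix.diagonal_one, mul_one] at h
  rw [h]
  ext x y
  have hxy : x = y ↔ x 0 = y 0 :=
    ⟨fun h => by rw [h], fun h => funext fun i => by rw [Subsingleton.elim i 0, h]⟩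
  have hs' : starRingEnd ℂ s * s = 1 := hs
  simp only [Matrix.of_apply, Matrix.one_apply, hxy]
  cases x 0 <;> cases y 0 <;> simp
  linear_combination hs'

theorem hadamard_conj_pauliZ {s : ℂ} (hs : star s = s) :
    (hadamard s).conjTranspose * pauliZ 0 * hadamard s = s • pauliX := by
  have hz : pauliZ (0 : Fin 1) = Matrix.diagonal fun x => bif x 0 then -1 else 1 := by
    rw [pauliZ, bitProj, bitProj, Matrix.diagonal_sub]
    congr 1
    funext x
    cases x 0 <;> simp
  rw [hz, hadamard_conj s fun b => bif b then -1 else 1]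
  ext x y
  have hxy : (x = fun i => !(y i)) ↔ x 0 = !(y 0) :=
    ⟨fun h => by rw [h], fun h => funext fun i => by rw [Subsingleton.elim i 0, h]⟩
  simp only [Matrix.of_apply, Matrix.smul_apply, pauliX, permOp, hxy, hs]
  cases x 0 <;> cases y 0 <;> simp <;> ring

theorem pauliX_mem_unitary : pauliX ∈ QUnitary (Fin 1) := permOp_mem_unitary involutive_not

theorem bitProj_mul_pauliX : bitProj 0 false * pauliX = pauliX * bitProj 0 true := by
  rw [pauliX, bitProj, bitProj, permOp_mul_diagonal involutive_not]
  congr 2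
  funext x
  cases h : x 0 <;> simp [h]

end Hadamard

/-! ### Off-diagonal blocks of the Hadamard test -/

section Conj

/-- In the application `B`, `B'` and `X` act on the control qubit and so commute with `p` and `s`.
An identity between blocks therefore survives the passage from y to p (y − s y s) p. -/
theorem block_compression {𝒜 : Type*} [Ring 𝒜] {B B' X p s y w : 𝒜} (hBp : Commute B p)
    (hBs : Commute B s) (hBp' : Commute B' p) (hBs' : Commute B' s) (hXp : Commute X p)
    (hXs : Commute X s) (h : B * y * B' = X * (B' * w)) :
    B * (p * (y - s * y * s) * p) * B' = X * (B' * (p * (w - s * w * s) * p)) := by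
  calc _ = (B * p) * (y - s * y * s) * (p * B') := by noncomm_ring
    _ = p * (B * y * B' - (B * s) * y * (s * B')) * p := by
      rw [hBp.eq, ← hBp'.eq]; noncomm_ring
    _ = p * (B * y * B' - s * (B * y * B') * s) * p := by
      rw [hBs.eq, ← hBs'.eq]; noncomm_ring
    _ = (p * X) * B' * w * p - p * (s * X) * B' * w * s * p := by rw [h]; noncomm_ring
    _ = (X * p) * B' * w * p - (p * X) * s * B' * w * s * p := by
      rw [← hXs.eq, hXp.eq]; noncomm_ring
    _ = X * (p * B') * w * p - (X * p) * (s * B') * w * s * p := by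
      rw [hXp.eq, ← mul_assoc X, hXp.eq]; noncomm_ring
    _ = X * (B' * p) * w * p - X * p * (B' * s) * w * s * p := by
      rw [hBp'.eq, hBs'.eq]
    _ = X * (B' * p) * w * p - X * (B' * p) * s * w * s * p := by
      rw [hBp'.eq]; noncomm_ring
    _ = _ := by noncomm_ring

variable {ι κ : Type} [Fintype ι] [DecidableEq ι] [Fintype κ] [DecidableEq κ]

theorem pauliZ_eq_onQubits (i : ι) : pauliZ i = onQubits (oneQubit i) (pauliZ 0) := by
  rw [pauliZ, pauliZ, ← onQubitsHom_apply, map_sub, onQubitsHom_apply, onQubitsHom_apply,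
    bitProj_eq_onQubits, bitProj_eq_onQubits]
  rfl

/-- The block of the observable `Z` on the control qubit, after a controlled operation and a
Hadamard gate. -/
theorem bitProj_conj_controlled {c : ι} {j : κ ↪ ι} (hc : c ∉ Set.range j) {s : ℂ}
    (hs : star s = s) (W : QOp κ) :
    bitProj c false * (star (onQubits (oneQubit c) (hadamard s) * controlled c j W) * pauliZ c *
      (onQubits (oneQubit c) (hadamard s) * controlled c j W)) * bitProj c true =
      s • (onQubits (oneQubit c) pauliX * (bitProj c true * onQubits j W)) := by
  have h1 : (onQubits (oneQubit c) (hadamard s)).conjTranspose * pauliZ c *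
      onQubits (oneQubit c) (hadamard s) = s • onQubits (oneQubit c) pauliX := by
    rw [pauliZ_eq_onQubits, ← onQubits_conjTranspose, ← onQubits_mul, ← onQubits_mul,
      hadamard_conj_pauliZ hs, onQubits_smul]
  have h2 : bitProj c false * (controlled c j W).conjTranspose = bitProj c false := by
    rw [← controlled_conjTranspose hc, controlled, mul_add, bitProj_mul_self, ← mul_assoc,
      bitProj_false_mul_true, zero_mul, add_zero]
  have h3 : controlled c j W * bitProj c true = bitProj c true * onQubits j W := by
    rw [controlled, add_mul, bitProj_false_mul_true, zero_add, mul_assoc,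
      ← (bitProj_commute_onQubits hc true W).eq, ← mul_assoc, bitProj_mul_self]
  have h4 : bitProj c false * onQubits (oneQubit c) pauliX =
      onQubits (oneQubit c) pauliX * bitProj c true := by
    have e : ∀ b, bitProj c b = onQubits (oneQubit c) (bitProj 0 b) := fun b =>
      (bitProj_eq_onQubits (oneQubit c) 0 b).symm
    rw [e, e, ← onQubits_mul, ← onQubits_mul, bitProj_mul_pauliX]
  rw [star_mul, Matrix.star_eq_conjTranspose, Matrix.star_eq_conjTranspose]
  set H := onQubits (oneQubit c) (hadamard s)
  set C := controlled c j W
  calc _ = (bitProj c false * C.conjTranspose) * (H.conjTranspose * pauliZ c * H) *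
        (C * bitProj c true) := by noncomm_ring
    _ = s • (bitProj c false * onQubits (oneQubit c) pauliX *
        (bitProj c true * onQubits j W)) := by
      rw [h1, h2, h3, mul_smul_comm, smul_mul_assoc]
    _ = s • (onQubits (oneQubit c) pauliX * ((bitProj c true * bitProj c true) *
        onQubits j W)) := by rw [h4]; noncomm_ring
    _ = _ := by rw [bitProj_mul_self]

end Conj

/-! ### The Hadamard test as a swap binding adversary -/

namespace QSC

variable (S : QSC) {κ : ℕ} (r : ℕ)

/-- The register `R` extended by one qubit, inside `(D, R)`. -/
def extDR : S.DReg κ ⊕ Fin r ↪ S.DReg κ ⊕ Fin (r + 1) :=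
  ⟨Sum.map id Fin.castSucc, Function.injective_id.sumMap (Fin.castSucc_injective r)⟩

/-- The register `R` extended by one qubit, inside the whole system. -/
def extTotal : S.Total κ r ↪ S.Total κ (r + 1) :=
  ⟨Sum.map (Sum.map id Fin.castSucc) id,
    (Function.injective_id.sumMap (Fin.castSucc_injective r)).sumMap Function.injective_id⟩

/-- The new qubit of the extended register `R`, inside the whole system. -/
def ctrlTotal : S.Total κ (r + 1) := Sum.inl (Sum.inr (Fin.last r))

theorem ctrlTotal_notMem : S.ctrlTotal (κ := κ) r ∉ Set.range (S.extTotal (κ := κ) r) := by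
  rintro ⟨(⟨i | i⟩ | i), hi⟩
  all_goals
    simp only [extTotal, ctrlTotal, Function.Embedding.coeFn_mk, Sum.map_inl, Sum.map_inr,
      Sum.inl.injEq, Sum.inr.injEq, reduceCtorEq] at hi
  exact Fin.castSucc_ne_last i hi

theorem ctrlDR_notMem :
    (Sum.inr (Fin.last r) : S.DReg κ ⊕ Fin (r + 1)) ∉ Set.range (S.extDR (κ := κ) r) := by
  rintro ⟨i | i, hi⟩
  all_goals
    simp only [extDR, Function.Embedding.coeFn_mk, Sum.map_inl, Sum.map_inr, Sum.inr.injEq,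
      reduceCtorEq] at hi
  exact Fin.castSucc_ne_last i hi

/-- The unitary of the Hadamard test of `U`. -/
def testOp (s : ℂ) (U : QOp (S.DReg κ ⊕ Fin r)) : QOp (S.DReg κ ⊕ Fin (r + 1)) :=
  onQubits (oneQubit (Sum.inr (Fin.last r))) (hadamard s) *
    controlled (Sum.inr (Fin.last r)) (S.extDR r) U

theorem testOp_mem_unitary {s : ℂ} (hs : star s * s = 1) {U : QOp (S.DReg κ ⊕ Fin r)}
    (hU : U ∈ QUnitary (S.DReg κ ⊕ Fin r)) :
    S.testOp r s U ∈ QUnitary (S.DReg κ ⊕ Fin (r + 1)) :=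
  mul_mem (onQubits_mem_unitary _ (hadamard_mem_unitary hs))
    (controlled_mem_unitary (S.ctrlDR_notMem r) hU)

theorem advOp_testOp (s : ℂ) (U : QOp (S.DReg κ ⊕ Fin r)) :
    S.advOp (r + 1) (S.testOp r s U) =
      onQubits (oneQubit (S.ctrlTotal r)) (hadamard s) *
        controlled (S.ctrlTotal r) (S.extTotal r) (S.advOp r U) := by
  have he : (S.extDR r).trans (S.embDR (κ := κ) (r + 1)) = (S.embDR r).trans (S.extTotal r) := by
    ext i
    rcases i with i | i <;> rfl
  have ho : (oneQubit (Sum.inr (Fin.last r))).trans (S.embDR (κ := κ) (r + 1)) =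
      oneQubit (S.ctrlTotal r) := rfl
  rw [advOp, testOp, onQubits_mul, ← onQubits_trans, ho, controlled, controlled, onQubits_add,
    onQubits_mul, bitProj_eq_onQubits, bitProj_eq_onQubits, ← onQubits_trans, he, onQubits_trans]
  rfl

theorem swapHat_succ : S.swapHat (κ := κ) (r + 1) = onQubits (S.extTotal r) (S.swapHat r) := by
  have h1 : S.embMW (κ := κ) (r + 1) = (S.embMW r).trans (S.extTotal r) := rfl
  have h2 : S.embSwap (κ := κ) (r + 1) = (S.embSwap r).trans (S.extTotal r) := by
    ext i
    rcases i with i | i <;> rfl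
  rw [swapHat, swapHat, hat, hat, comT, swapMM, h1, h2, onQubits_trans, onQubits_trans,
    onQubits_mul, onQubits_mul, onQubits_conjTranspose]
  rfl

theorem startProj_succ :
    S.startProj (κ := κ) (r + 1) = onQubits (S.extTotal r) (S.startProj r) := by
  have h1 : S.embMW (κ := κ) (r + 1) = (S.embMW r).trans (S.extTotal r) := rfl
  have h2 : S.embW (κ := κ) (r + 1) = (S.embW r).trans (S.extTotal r) := rfl
  have h3 : S.embFresh (κ := κ) (r + 1) = (S.embFresh r).trans (S.extTotal r) := rfl
  rw [startProj, startProj, validProj, validProj, hat, hat, comT, zeroW, freshZero, h1, h2, h3,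
    onQubits_trans, onQubits_trans, onQubits_trans, onQubits_mul, onQubits_mul, onQubits_mul,
    onQubits_conjTranspose]
  rfl

/-- The adversary that performs the Hadamard test of `U`. -/
def testAdversary {s : ℂ} (hs : star s * s = 1) {U : QOp (S.DReg κ ⊕ Fin r)}
    (hU : U ∈ QUnitary (S.DReg κ ⊕ Fin r)) {ρ : QOp (S.MW κ ⊕ Fin (r + 1))} (hρ : IsDensity ρ) :
    Adversary S κ where
  r := r + 1
  init := ρ
  init_density := hρ
  prep := 1
  guess := ⟨S.testOp r s U, S.testOp_mem_unitary r hs hU⟩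
  out := Fin.last r

theorem testAdversary_winProb {s : ℂ} (hs : star s * s = 1) {U : QOp (S.DReg κ ⊕ Fin r)}
    (hU : U ∈ QUnitary (S.DReg κ ⊕ Fin r)) {ρ : QOp (S.MW κ ⊕ Fin (r + 1))} (hρ : IsDensity ρ) :
    (S.testAdversary r hs hU hρ).winProb =
      (∑ b : Bool, S.outputProb (r + 1) b b ρ (S.advOp (r + 1) (S.testOp r s U))
        (Fin.last r)) / 2 := by
  have h : (S.testAdversary r hs hU hρ).sent = ρ := by
    have : (1 : QOp (S.MW κ ⊕ Fin (r + 1))) * ρ *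
        (1 : QOp (S.MW κ ⊕ Fin (r + 1))).conjTranspose = ρ := by
      rw [Matrix.conjTranspose_one, mul_one, one_mul]
    exact this
  rw [Adversary.winProb, h]
  rfl

/-- The test observable is Hermitian, and its off-diagonal block on the control qubit is, up to a
flip, the operator U, which need not be Hermitian. Expectations over all states bound the norm of
the whole observable, hence that of the block. -/
theorem norm_startProj_conj_le {U : QOp (S.DReg κ ⊕ Fin r)}
    (hU : U ∈ QUnitary (S.DReg κ ⊕ Fin r)) {ε : ℝ} (hε : 0 ≤ ε)
    (h : ∀ (s : ℂ) (hs : star s * s = 1) (ρ : QOp (S.MW κ ⊕ Fin (r + 1))) (hρ : IsDensity ρ),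
      (S.testAdversary r hs hU hρ).winProb ≤ 1 / 2 + ε) :
    ‖S.startProj r * (S.advOp r U - S.swapHat r * S.advOp r U * S.swapHat r) *
      S.startProj r‖ ≤ 4 * ε := by
  set W := S.advOp r U with hW
  set p' := S.startProj (κ := κ) (r + 1) with hp'
  set s' := S.swapHat (κ := κ) (r + 1) with hs'
  set c := S.ctrlTotal (κ := κ) r with hc
  have hp'p := S.isStarProjection_startProj (κ := κ) (r + 1)
  set Y : ℂ → QOp (S.Total κ (r + 1)) := fun s =>
    star (S.advOp (r + 1) (S.testOp r s U)) * pauliZ c * S.advOp (r + 1) (S.testOp r s U) with hY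
  set Q : ℂ → QOp (S.Total κ (r + 1)) := fun s => p' * (Y s - s' * Y s * s') * p' with hQ
  have hp's : star p' = p' := hp'p.isSelfAdjoint.star_eq
  have hs's : star s' = s' := (S.swapHat_isSelfAdjoint (r + 1)).star_eq
  have hYH : ∀ s, star (Y s) = Y s := fun s => by
    have : star (pauliZ c) = pauliZ c := by
      rw [pauliZ, star_sub, Matrix.star_eq_conjTranspose, Matrix.star_eq_conjTranspose,
        bitProj_conjTranspose, bitProj_conjTranspose]
    rw [hY]
    simp only [star_mul, star_star, this, mul_assoc]
  have hQH : ∀ s, (Q s).IsHermitian := fun s => by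
    change star (Q s) = Q s
    rw [hQ]
    simp only [star_mul, star_sub, hp's, hs's, hYH, mul_assoc]
  -- The sign s = −1 negates the observable, so the one-sided bounds on the winning probabilities
  -- for s = ±1 bound the absolute value of the expectation.
  have hneg : Q (-1) = -Q 1 := by
    have hYneg : Y (-1) = -Y 1 := by
      have hcH : ∀ s : ℂ, star s = s → Y s = s • (star (controlled c (S.extTotal r) W) *
          onQubits (oneQubit c) pauliX * controlled c (S.extTotal r) W) := by
        intro s hs
        have h1 : star (onQubits (oneQubit c) (hadamard s)) * pauliZ c *
            onQubits (oneQubit c) (hadamard s) = s • onQubits (oneQubit c) pauliX := by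
          rw [pauliZ_eq_onQubits, Matrix.star_eq_conjTranspose, ← onQubits_conjTranspose,
            ← onQubits_mul, ← onQubits_mul, hadamard_conj_pauliZ hs, onQubits_smul]
        rw [hY]
        dsimp only
        rw [advOp_testOp, star_mul]
        calc _ = star (controlled c (S.extTotal r) W) *
              (star (onQubits (oneQubit c) (hadamard s)) * pauliZ c *
              onQubits (oneQubit c) (hadamard s)) * controlled c (S.extTotal r) W := by
              simp only [mul_assoc, hW, hc]
          _ = _ := by rw [h1, mul_smul_comm, smul_mul_assoc]
      rw [hcH (-1) (by simp), hcH 1 (by simp), one_smul, neg_smul, one_smul]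
    rw [hQ]
    dsimp only
    rw [hYneg]
    noncomm_ring
  have hz : tensorOp (1 : QOp (S.MW κ ⊕ Fin (r + 1))) (zeroProj (Fin (S.n κ))) =
      S.freshZero (r + 1) := by
    rw [tensorOp_eq, onQubits_one, one_mul]
    rfl
  have hpz : p' * S.freshZero (r + 1) = p' := by
    rw [hp', startProj, mul_assoc, (S.isStarProjection_freshZero (r + 1)).isIdempotentElem.eq]
  have hzp : S.freshZero (r + 1) * p' = p' := by
    have := congrArg star hpz
    rwa [star_mul, hp's, (S.isStarProjection_freshZero (r + 1)).isSelfAdjoint.star_eq] at this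
  have hwin : ∀ (s : ℂ) (hs : star s * s = 1) (ρ : QOp (S.MW κ ⊕ Fin (r + 1)))
      (hρ : IsDensity ρ),
      (tensorOp ρ (zeroProj (Fin (S.n κ))) * Q s).trace.re ≤ 4 * ε := by
    intro s hs ρ hρ
    have h1 := h s hs ρ hρ
    rw [testAdversary_winProb] at h1
    have h3 := S.sum_outputProb_eq (r + 1) ρ
      (V := fun _ => S.advOp (r + 1) (S.testOp r s U))
      (fun _ => onQubits_mem_unitary _ (S.testOp_mem_unitary r hs hU)) (Fin.last r)
    have h4 := h3.symm.trans_le h1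
    have h5 : star (S.advOp (r + 1) (S.testOp r s U) * p') * pauliZ c *
          (S.advOp (r + 1) (S.testOp r s U) * p') -
        star (S.advOp (r + 1) (S.testOp r s U) * (s' * p')) * pauliZ c *
          (S.advOp (r + 1) (S.testOp r s U) * (s' * p')) = Q s := by
      rw [hQ, hY]
      simp only [star_mul, hp's, hs's]
      noncomm_ring
    have h6 : (Sum.inl (Sum.inr (Fin.last r)) : S.Total κ (r + 1)) = c := rfl
    rw [h6, h5] at h4
    linarith
  have hQn : ‖Q 1‖ ≤ 4 * ε := by
    refine norm_le_of_forall_tensorOp_trace_re_le (hQH 1) ?_ (by positivity) fun ρ hρ => ?_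
    · rw [hz, hQ]
      dsimp only
      rw [← mul_assoc, ← mul_assoc, hzp, mul_assoc, hpz]
    · rw [abs_le]
      have h1 := hwin 1 (by simp) ρ hρ
      have h2 := hwin (-1) (by simp) ρ hρ
      rw [hneg, mul_neg, Matrix.trace_neg, Complex.neg_re] at h2
      exact ⟨by linarith, h1⟩
  have hcn := S.ctrlTotal_notMem (κ := κ) r
  have hpc : ∀ b, Commute (bitProj c b) p' := fun b => by
    rw [hp', startProj_succ]
    exact bitProj_commute_onQubits hcn b _
  have hsc : ∀ b, Commute (bitProj c b) s' := fun b => by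
    rw [hs', swapHat_succ]
    exact bitProj_commute_onQubits hcn b _
  have hX : ∀ A : QOp (S.Total κ r),
      Commute (onQubits (oneQubit c) pauliX) (onQubits (S.extTotal r) A) := fun A => by
    refine onQubits_commute _ _ ?_ _ _
    rw [Set.disjoint_left]
    rintro _ ⟨_, rfl⟩
    exact hcn
  set X := onQubits (oneQubit c) pauliX with hXdef
  have hXu : X ∈ unitary (QOp (S.Total κ (r + 1))) := onQubits_mem_unitary _ pauliX_mem_unitary
  set J : QOp (S.Total κ r) → QOp (S.Total κ (r + 1)) := onQubits (S.extTotal r) with hJ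
  set D := S.startProj r * (W - S.swapHat r * W * S.swapHat r) * S.startProj r with hD
  have hblock : bitProj c false * Q 1 * bitProj c true = X * (J D * bitProj c true) := by
    have h1 : bitProj c false * Y 1 * bitProj c true = X * (bitProj c true * J W) := by
      have := bitProj_conj_controlled hcn (s := 1) (by simp) W
      rw [one_smul] at this
      rw [hY]
      dsimp only
      rw [advOp_testOp]
      exact this
    have hXp : Commute X p' := by
      rw [hp', startProj_succ]
      exact hX _
    have hXs : Commute X s' := by
      rw [hs', swapHat_succ]
      exact hX _
    have hJD : J D = p' * (J W - s' * J W * s') * p' := by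
      rw [hp', hs', startProj_succ, swapHat_succ, hD, hJ]
      rw [← onQubitsHom_apply, ← onQubitsHom_apply, ← onQubitsHom_apply, ← onQubitsHom_apply]
      simp only [map_mul, map_sub]
    have hDc : Commute (bitProj c true) (J D) := bitProj_commute_onQubits hcn true _
    rw [← hDc.eq, hJD]
    exact block_compression (hpc false) (hsc false) (hpc true) (hsc true) hXp hXs h1
  -- Neither the flip X nor tensoring with |1⟩⟨1| on the control qubit changes the norm.
  have hn : ‖D‖ = ‖bitProj c false * Q 1 * bitProj c true‖ := by
    rw [hblock, CStarRing.norm_mem_unitary_mul _ hXu]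
    have e : bitProj c true = onQubits (oneQubit c) (bitProj 0 true) :=
      (bitProj_eq_onQubits (oneQubit c) 0 true).symm
    rw [e]
    refine (norm_onQubits_mul_proj _ _ ?_ (isStarProjection_bitProj _ _)
      (b := fun _ => true) (by simp [bitProj]) D).symm
    rw [Set.disjoint_right]
    rintro _ ⟨_, rfl⟩
    exact hcn
  rw [hn]
  refine (norm_mul_le _ _).trans ?_
  have h1 : ‖bitProj c false * Q 1‖ ≤ 1 * (4 * ε) := (norm_mul_le _ _).trans
    (mul_le_mul (isStarProjection_bitProj c false).norm_le hQn (norm_nonneg _) zero_le_one)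
  calc _ ≤ (1 * (4 * ε)) * 1 := mul_le_mul h1 (isStarProjection_bitProj c true).norm_le
        (norm_nonneg _) (by positivity)
    _ = 4 * ε := by ring

end QSC

/-! ### The output observable as a gate -/

section PauliZ

variable {ι : Type} [Fintype ι] [DecidableEq ι]

theorem pauliZ_mem_unitary (i : ι) : pauliZ i ∈ QUnitary ι := by
  have : pauliZ i = Matrix.diagonal fun x : ι → Bool => bif x i then -1 else 1 := by
    rw [pauliZ, bitProj, bitProj, Matrix.diagonal_sub]
    congr 1
    funext x
    cases x i <;> simp
  rw [this]
  refine diagonal_mem_unitary fun x => ?_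
  cases x i <;> simp

theorem isGate_oneQubit (i : ι) {A : QOp (Fin 1)} (hA : A ∈ QUnitary (Fin 1)) :
    IsGate (onQubits (oneQubit i) A) :=
  ⟨1, oneQubit i, ⟨A, hA⟩, by norm_num, rfl⟩

theorem pauliZ_star (i : ι) : star (pauliZ i) = pauliZ i := by
  rw [pauliZ, star_sub, Matrix.star_eq_conjTranspose, Matrix.star_eq_conjTranspose,
    bitProj_conjTranspose, bitProj_conjTranspose]

theorem isGate_pauliZ (i : ι) : IsGate (pauliZ i) := by
  rw [pauliZ_eq_onQubits]
  exact isGate_oneQubit i (pauliZ_mem_unitary 0)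

end PauliZ

/-! ### From Hadamard tests to oracle adversaries -/

namespace QSC

variable (S : QSC) {κ : ℕ} (r : ℕ)

theorem hasCircuit_testOp {s : ℂ} (hs : star s * s = 1) {N : ℕ} {U : QOp (S.DReg κ ⊕ Fin r)}
    (hU : HasCircuit N U) : HasCircuit (1 + 7 * N) (S.testOp r s U) :=
  (isGate_oneQubit _ (hadamard_mem_unitary hs)).hasCircuit.mul (hU.controlled (S.ctrlDR_notMem r))

/-- All Hadamard tests of `U` have advantage at most `ε` in the swap binding experiment. -/
def PassesTests (ε : ℝ) (U : QOp (S.DReg κ ⊕ Fin r)) : Prop :=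
  ∀ (hU : U ∈ QUnitary (S.DReg κ ⊕ Fin r)) (s : ℂ) (hs : star s * s = 1)
    (ρ : QOp (S.MW κ ⊕ Fin (r + 1))) (hρ : IsDensity ρ),
    (S.testAdversary r hs hU hρ).winProb ≤ 1 / 2 + ε

variable {S}

theorem OracleAdversary.oracle_eq (A : OracleAdversary S κ) (b : Bool) :
    A.oracle b = condUnitary (S.swapHat A.r ^ b.toNat * S.hat A.r (onQubits (S.embMR A.r) A.O.1) *
      S.swapHat A.r ^ b.toNat) (S.validProj A.r) := rfl

theorem OracleAdversary.oracle_mem_unitary (A : OracleAdversary S κ) (b : Bool) :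
    A.oracle b ∈ QUnitary (S.Total κ A.r) := by
  have hS : S.swapHat (κ := κ) A.r ∈ unitary (QOp (S.Total κ A.r)) := by
    rw [Unitary.mem_iff, (S.swapHat_isSelfAdjoint A.r).star_eq]
    exact ⟨S.swapHat_mul_self A.r, S.swapHat_mul_self A.r⟩
  have hc := (S.swapHat_commute_validProj (κ := κ) A.r).pow_left b.toNat
  have hO : S.hat A.r (onQubits (S.embMR A.r) A.O.1) ∈ unitary (QOp (S.Total κ A.r)) :=
    S.hat_mem_unitary A.r (onQubits_mem_unitary _ A.O.2)
  rw [oracle_eq]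
  exact condUnitary_mem_unitary (mul_mem (mul_mem (pow_mem hS _) hO) (pow_mem hS _))
    (S.isStarProjection_validProj A.r)
    ((hc.mul_left (S.hat_onQubits_embMR_commute_validProj A.r _)).mul_left hc)

theorem OracleAdversary.run_mem_unitary (A : OracleAdversary S κ) (b : Bool) :
    A.run b ∈ QUnitary (S.Total κ A.r) := by
  have : ∀ (L : List (QUnitary (S.DReg κ ⊕ Fin A.r))) (V : QOp (S.Total κ A.r)),
      V ∈ QUnitary (S.Total κ A.r) →
      L.foldl (fun V U => onQubits (S.embDR A.r) U.1 * A.oracle b * V) V ∈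
        QUnitary (S.Total κ A.r) := by
    intro L
    induction L with
    | nil => exact fun V hV => hV
    | cons U L ih =>
      intro V hV
      exact ih _ (mul_mem (mul_mem (onQubits_mem_unitary _ U.2) (A.oracle_mem_unitary b)) hV)
  exact this _ _ (onQubits_mem_unitary _ A.guess.2)

/-- Induction on the queries. The set `𝒱 t` contains the products accumulated after t queries. A
term created by a query starts afresh with the unitary that follows it, which is why `hrest` asks
for U itself at every stage. -/
theorem OracleAdversary.isHistory_run (A : OracleAdversary S κ)
    {𝒱 : ℕ → Set (QOp (S.DReg κ ⊕ Fin A.r))} {δ : ℝ} (hδ : 0 ≤ δ) (hguess : A.guess.1 ∈ 𝒱 0)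
    (hrest : ∀ U ∈ A.rest, ∀ t, U.1 ∈ 𝒱 (t + 1))
    (hmul : ∀ U ∈ A.rest, ∀ t, ∀ W ∈ 𝒱 t, U.1 * W ∈ 𝒱 (t + 1))
    (hbound : ∀ t ≤ A.rest.length, ∀ W ∈ 𝒱 t,
      ‖S.validProj A.r * (S.advOp A.r W - S.swapHat A.r * S.advOp A.r W * S.swapHat A.r) *
        S.startProj A.r‖ ≤ δ) :
    IsHistory (S.advOp A.r '' 𝒱 A.rest.length) (S.swapHat A.r) (S.startProj A.r) A.rest.length δ
      (A.run false * S.startProj A.r) (A.run true * (S.swapHat A.r * S.startProj A.r)) := by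
  have hS : S.swapHat (κ := κ) A.r ∈ unitary (QOp (S.Total κ A.r)) := by
    rw [Unitary.mem_iff, (S.swapHat_isSelfAdjoint A.r).star_eq]
    exact ⟨S.swapHat_mul_self A.r, S.swapHat_mul_self A.r⟩
  have key : ∀ (L : List (QUnitary (S.DReg κ ⊕ Fin A.r))), (∀ U ∈ L, U ∈ A.rest) →
      ∀ (t : ℕ), t + L.length = A.rest.length → ∀ V V' : QOp (S.Total κ A.r),
      IsHistory (S.advOp A.r '' 𝒱 t) (S.swapHat A.r) (S.startProj A.r) t δ (V * S.startProj A.r)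
        (V' * (S.swapHat A.r * S.startProj A.r)) →
      IsHistory (S.advOp A.r '' 𝒱 A.rest.length) (S.swapHat A.r) (S.startProj A.r) A.rest.length δ
        (L.foldl (fun V U => onQubits (S.embDR A.r) U.1 * A.oracle false * V) V * S.startProj A.r)
        (L.foldl (fun V U => onQubits (S.embDR A.r) U.1 * A.oracle true * V) V' *
          (S.swapHat A.r * S.startProj A.r)) := by
    intro L
    induction L with
    | nil =>
      intro _ t ht V V' h
      rw [List.length_nil, add_zero] at ht
      rwa [ht] at h
    | cons U L ih =>
      intro hL t ht V V' h
      have hUr := hL U List.mem_cons_self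
      refine ih (fun U hU => hL U (List.mem_cons_of_mem _ hU)) (t + 1)
        (by rw [← ht, List.length_cons]; ring) _ _ ?_
      have hstep := IsHistory.query (𝒱' := S.advOp A.r '' 𝒱 (t + 1)) (U := S.advOp A.r U.1) h hδ
        (S.swapHat_isSelfAdjoint A.r) (S.swapHat_mul_self A.r) (S.isStarProjection_validProj A.r)
        (S.isStarProjection_freshZero A.r) (S.swapHat_commute_validProj A.r)
        (S.validProj_commute_freshZero A.r)
        (S.hat_mem_unitary A.r (onQubits_mem_unitary (S.embMR A.r) A.O.2))
        (S.hat_onQubits_embMR_commute_validProj A.r A.O.1)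
        (S.hat_onQubits_embMR_commute_freshZero A.r A.O.1)
        (onQubits_mem_unitary _ U.2)
        (by
          rintro _ ⟨W, -, rfl⟩
          exact S.advOp_commute_freshZero A.r W)
        ⟨U.1, hrest U hUr t, rfl⟩
        (by
          rintro _ ⟨W, hW, rfl⟩
          exact ⟨U.1 * W, hmul U hUr t W hW, onQubits_mul _ _ _⟩)
        (by
          rintro _ ⟨W, hW, rfl⟩
          exact hbound t (by omega) W hW)
      rw [← mul_assoc (S.advOp A.r U.1 * _) V, ← mul_assoc (S.advOp A.r U.1 * _) V'] at hstep
      have e0 : A.oracle false = condUnitary (S.hat A.r (onQubits (S.embMR A.r) A.O.1))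
          (S.validProj A.r) := by
        rw [oracle_eq]; simp
      have e1 : A.oracle true = condUnitary (S.swapHat A.r *
          S.hat A.r (onQubits (S.embMR A.r) A.O.1) * S.swapHat A.r) (S.validProj A.r) := by
        rw [oracle_eq]; simp
      rw [e0, e1]
      exact hstep
  refine key A.rest (fun _ h => h) 0 (zero_add _) _ _ ?_
  exact isHistory_zero hS (S.isStarProjection_startProj A.r) (onQubits_mem_unitary _ A.guess.2)
    (Set.mem_image_of_mem (S.advOp A.r) hguess) δ

/-- The advantage of an oracle adversary is controlled by the advantage of the Hadamard tests of the
products of its unitaries. -/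
theorem OracleAdversary.oracleWinProb_le (A : OracleAdversary S κ)
    {𝒱 : ℕ → Set (QOp (S.DReg κ ⊕ Fin A.r))} {ε : ℝ} (hε : 0 ≤ ε) (hε1 : ε ≤ 1)
    (hunit : ∀ t, ∀ W ∈ 𝒱 t, W ∈ QUnitary (S.DReg κ ⊕ Fin A.r)) (hguess : A.guess.1 ∈ 𝒱 0)
    (hrest : ∀ U ∈ A.rest, ∀ t, U.1 ∈ 𝒱 (t + 1))
    (hmul : ∀ U ∈ A.rest, ∀ t, ∀ W ∈ 𝒱 t, U.1 * W ∈ 𝒱 (t + 1))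
    (htest : ∀ t ≤ A.rest.length, ∀ W ∈ 𝒱 t, S.PassesTests A.r ε W)
    (htest' : ∀ V ∈ 𝒱 A.rest.length, ∀ W ∈ 𝒱 A.rest.length,
      S.PassesTests A.r ε (star V * pauliZ (Sum.inr A.out) * W)) :
    A.oracleWinProb ≤ 1 / 2 + 280 * ((A.rest.length : ℝ) + 1) ^ 4 * ε := by
  set q := A.rest.length
  set p := S.startProj (κ := κ) A.r with hp
  set s := S.swapHat (κ := κ) A.r with hs
  have hpp := S.isStarProjection_startProj (κ := κ) A.r
  have hps : star p = p := hpp.isSelfAdjoint.star_eq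
  have hss : star s = s := (S.swapHat_isSelfAdjoint A.r).star_eq
  set Z : QOp (S.Total κ A.r) := pauliZ (Sum.inl (Sum.inr A.out)) with hZ
  have hZadv : S.advOp A.r (pauliZ (Sum.inr A.out)) = Z := by
    rw [advOp, pauliZ, ← onQubitsHom_apply, map_sub, onQubitsHom_apply, onQubitsHom_apply,
      bitProj_eq_onQubits, bitProj_eq_onQubits]
    rfl
  -- The Hadamard test gives 4ε and the compression doubles it, hence δ = 8ε.
  have hhist := A.isHistory_run (𝒱 := 𝒱) (δ := 8 * ε) (by positivity) hguess hrest hmul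
    fun t ht W hW => by
      have := S.norm_validProj_mul_le A.r (S.norm_startProj_conj_le A.r (hunit t W hW) hε
        (htest t ht W hW (hunit t W hW)))
      linarith
  have hn := hhist.norm_conj_sub_le (B := Z) (by positivity) (S.swapHat_isSelfAdjoint A.r)
    hpp.isSelfAdjoint (norm_le_one_of_mem_unitary (pauliZ_mem_unitary _)) (by
      rintro _ ⟨V, hV, rfl⟩ _ ⟨W, hW, rfl⟩
      have hu : star V * pauliZ (Sum.inr A.out) * W ∈ QUnitary (S.DReg κ ⊕ Fin A.r) :=
        mul_mem (mul_mem (Unitary.star_mem (hunit q V hV)) (pauliZ_mem_unitary _)) (hunit q W hW)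
      have h := S.norm_startProj_conj_le A.r hu hε (htest' V hV W hW hu)
      have e : S.advOp A.r (star V * pauliZ (Sum.inr A.out) * W) =
          star (S.advOp A.r V) * Z * S.advOp A.r W := by
        rw [← hZadv]
        simp only [advOp, ← onQubitsHom_apply, map_mul, map_star]
      rw [e] at h
      linarith)
  set M := star (A.run false * p) * Z * (A.run false * p) -
    star (A.run true * (s * p)) * Z * (A.run true * (s * p)) with hM
  have hρ : IsDensity A.sent := by
    refine ⟨A.init_density.1.mul_mul_conjTranspose_same _, ?_⟩
    have : A.prep.1.conjTranspose * A.prep.1 = 1 := Matrix.mem_unitaryGroup_iff'.1 A.prep.2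
    rw [Adversary.sent, Matrix.trace_mul_comm, ← mul_assoc, this, one_mul, A.init_density.2]
  have hMH : M.IsHermitian := by
    change star M = M
    have : star Z = Z := pauliZ_star _
    rw [hM]
    simp only [star_sub, star_mul, star_star, this, mul_assoc]
  have hρ' : IsDensity (tensorOp A.sent (zeroProj (Fin (S.n κ)))) := hρ.tensorOp_zeroProj
  have htr : (tensorOp A.sent (zeroProj (Fin (S.n κ))) * M).trace.re ≤ ‖M‖ :=
    trace_re_mul_le_of_posSemidef hρ'.1 hρ'.2 hMH
  have hwin : A.oracleWinProb = 1 / 2 + 1 / 4 *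
      (tensorOp A.sent (zeroProj (Fin (S.n κ))) * M).trace.re :=
    S.sum_outputProb_eq A.r A.sent (V := A.run) A.run_mem_unitary A.out
  rw [hwin]
  have hq : (0 : ℝ) ≤ q := Nat.cast_nonneg q
  -- The terms are 8(q+1)²ε, 16q²ε and 256q⁴ε², with 280 = 8 + 16 + 256; ε ≤ 1 makes the last one
  -- linear in ε.
  have hb : (1 : ℝ) / 4 * (4 * ((q : ℝ) + 1) ^ 2 * (8 * ε) +
      4 * (q : ℝ) ^ 2 * (8 * ε) * (2 + 4 * (q : ℝ) ^ 2 * (8 * ε))) ≤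
      280 * ((q : ℝ) + 1) ^ 4 * ε := by
    have h1 : (q : ℝ) ^ 4 * (ε * ε) ≤ (q : ℝ) ^ 4 * (1 * ε) := by gcongr
    have h2 : (0 : ℝ) ≤ (280 * (q + 1) ^ 4 - 8 * (q + 1) ^ 2 - 16 * q ^ 2 - 256 * q ^ 4) * ε := by
      refine mul_nonneg ?_ hε
      have : (280 * ((q : ℝ) + 1) ^ 4 - 8 * (q + 1) ^ 2 - 16 * q ^ 2 - 256 * q ^ 4) =
          272 + 1104 * q + 1656 * q ^ 2 + 1120 * q ^ 3 + 24 * q ^ 4 := by ring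
      rw [this]
      positivity
    nlinarith
  linarith

end QSC

/-! ### Negligible functions and square roots -/

section Negligible

/-- The n-th power of κ times √μ is the square root of κ^(2n) μ. -/
theorem Negligible.sqrt {μ : ℕ → ℝ} (hμ : Negligible μ) : Negligible fun κ => Real.sqrt (μ κ) := by
  refine ⟨fun κ => ⟨Real.sqrt_nonneg _, Real.sqrt_le_one.2 (hμ.1 κ).2⟩, fun n => ?_⟩
  have h := (Real.continuous_sqrt.tendsto 0).comp (hμ.2 (2 * n))
  rw [Real.sqrt_zero] at h
  refine h.congr fun κ => ?_
  rw [Function.comp_apply, Real.sqrt_mul (by positivity), mul_comm 2 n, pow_mul,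
    Real.sqrt_sq (by positivity)]

/-- Since p √μ tends to 0, it is eventually at most 1; multiply by √μ. Thus √μ is one bound that
serves every polynomial. -/
theorem Negligible.eventually_mul_le_sqrt {μ : ℕ → ℝ} (hμ : Negligible μ) (p : Polynomial ℝ) :
    ∀ᶠ κ : ℕ in atTop, p.eval (κ : ℝ) * μ κ ≤ Real.sqrt (μ κ) := by
  have h := (hμ.sqrt.2.polynomial_mul p) 0
  simp only [pow_zero, one_mul] at h
  filter_upwards [h.eventually_le_const zero_lt_one] with κ hκ
  calc p.eval (κ : ℝ) * μ κ = p.eval (κ : ℝ) * Real.sqrt (μ κ) * Real.sqrt (μ κ) := by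
        rw [mul_assoc, Real.mul_self_sqrt (hμ.1 κ).1]
    _ ≤ 1 * Real.sqrt (μ κ) := mul_le_mul_of_nonneg_right hκ (Real.sqrt_nonneg _)
    _ = _ := one_mul _

theorem Negligible.eventually_le_sqrt {μ : ℕ → ℝ} (hμ : Negligible μ) (p : Polynomial ℕ) :
    ∀ᶠ κ : ℕ in atTop, ∀ q : ℕ, q ≤ p.eval κ →
      280 * ((q : ℝ) + 1) ^ 4 * μ κ ≤ Real.sqrt (μ κ) := by
  filter_upwards [hμ.eventually_mul_le_sqrt
    (280 * (p.map (Nat.castRingHom ℝ) + 1) ^ 4)] with κ hκ q hq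
  refine le_trans ?_ hκ
  have h1 : (p.map (Nat.castRingHom ℝ)).eval (κ : ℝ) = ((p.eval κ : ℕ) : ℝ) := by
    rw [Polynomial.eval_natCast_map]
    rfl
  have h2 : (q : ℝ) ≤ ((p.eval κ : ℕ) : ℝ) := by exact_mod_cast hq
  have h3 : (280 * (p.map (Nat.castRingHom ℝ) + 1) ^ 4).eval (κ : ℝ) =
      280 * (((p.eval κ : ℕ) : ℝ) + 1) ^ 4 := by
    rw [Polynomial.eval_mul, Polynomial.eval_pow, Polynomial.eval_add, h1, Polynomial.eval_one]
    congr 1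
    exact Polynomial.eval_ofNat 280 _
  rw [h3]
  have := (hμ.1 κ).1
  gcongr

end Negligible

/-! ### Uniformity over adversaries and the two reductions -/

namespace QSC

variable {S : QSC}

/-- The threshold in the definition depends on the adversary family. Non-uniformity removes this:
take at each κ a violating adversary of the given size if there is one, and `A₀ κ` otherwise. Where
this single family obeys the bound, every adversary of that size does. -/
theorem CompSwapBinding.exists_uniform (h : S.CompSwapBinding) :
    ∃ μ : ℕ → ℝ, Negligible μ ∧ ∀ (p : Polynomial ℕ) (A₀ : ∀ κ, Adversary S κ),
      (∀ κ, (A₀ κ).SizeLE (p.eval κ)) →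
      ∀ᶠ κ in atTop, ∀ A : Adversary S κ, A.SizeLE (p.eval κ) → A.winProb ≤ 1 / 2 + μ κ := by
  obtain ⟨μ, hμ, h⟩ := h
  refine ⟨μ, hμ, fun p A₀ hA₀ => ?_⟩
  have hex : ∀ κ, ∃ A : Adversary S κ, A.SizeLE (p.eval κ) ∧ (A.winProb ≤ 1 / 2 + μ κ →
      ∀ A' : Adversary S κ, A'.SizeLE (p.eval κ) → A'.winProb ≤ 1 / 2 + μ κ) := by
    intro κ
    by_cases hb : ∃ A : Adversary S κ, A.SizeLE (p.eval κ) ∧ 1 / 2 + μ κ < A.winProb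
    · obtain ⟨A, hA, hlt⟩ := hb
      exact ⟨A, hA, fun hle => absurd hle (not_le.2 hlt)⟩
    · push Not at hb
      exact ⟨A₀ κ, hA₀ κ, fun _ => hb⟩
  choose A hA hA' using hex
  filter_upwards [h A ⟨p, hA⟩] with κ hκ
  exact hA' κ hκ

theorem Adversary.SizeLE.mono {κ T T' : ℕ} (hT : T ≤ T') {A : Adversary S κ} (hA : A.SizeLE T) :
    A.SizeLE T' :=
  ⟨hA.1.trans hT, hA.2.1.mono hT, hA.2.2.mono hT⟩

/-- A product of at most T + 1 of the adversary's circuits has (T + 1) T gates, so V†ZW has (T + 1)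
T + 1 + (T + 1) T. A Hadamard test of N gates costs 1 + 7N gates and one more qubit; the stated size
dominates both counts. -/
theorem OracleAdversary.oracleWinProb_le_of_size {κ T : ℕ} {ε : ℝ} (hε : 0 ≤ ε) (hε1 : ε ≤ 1)
    {A : OracleAdversary S κ} (hA : A.OracleSizeLE T)
    (h : ∀ A' : Adversary S κ, A'.SizeLE (T + 1 + (1 + 7 * ((T + 1) * T + 1 + (T + 1) * T))) →
      A'.winProb ≤ 1 / 2 + ε) :
    A.oracleWinProb ≤ 1 / 2 + 280 * ((A.rest.length : ℝ) + 1) ^ 4 * ε := by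
  obtain ⟨⟨hr, -, hg⟩, hq, hU, -⟩ := hA
  have hpass : ∀ (N : ℕ), N ≤ (T + 1) * T + 1 + (T + 1) * T →
      ∀ W : QOp (S.DReg κ ⊕ Fin A.r), HasCircuit N W → S.PassesTests A.r ε W := by
    intro N hN W hW hWu s hs ρ hρ
    refine h _ ⟨?_, hasCircuit_one _, (S.hasCircuit_testOp A.r hs hW).mono ?_⟩
    · change A.r + 1 ≤ _
      omega
    · omega
  refine A.oracleWinProb_le (𝒱 := fun t => {W | HasCircuit ((t + 1) * T) W}) hε hε1
    (fun t W hW => HasCircuit.mem_unitary hW) (hg.mono (by simp)) ?_ ?_ ?_ ?_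
  · intro U hUr t
    exact (hU U hUr).mono (by nlinarith)
  · intro U hUr t W hW
    exact ((hU U hUr).mul hW).mono (by ring_nf; rfl)
  · intro t ht W hW
    refine hpass _ ?_ W hW
    have : (t + 1) * T ≤ (T + 1) * T := Nat.mul_le_mul_right _ (by omega)
    omega
  · intro V hV W hW
    have : (A.rest.length + 1) * T ≤ (T + 1) * T := Nat.mul_le_mul_right _ (by omega)
    exact hpass _ (by omega) _ ((hV.conjTranspose.mul (isGate_pauliZ _).hasCircuit).mul hW)

/-- Without size bounds, all unitaries on (D, R) may be allowed at every stage of the history. -/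
theorem OracleAdversary.oracleWinProb_le_of_forall {κ : ℕ} {ε : ℝ} (hε : 0 ≤ ε) (hε1 : ε ≤ 1)
    (A : OracleAdversary S κ) (h : ∀ A' : Adversary S κ, A'.winProb ≤ 1 / 2 + ε) :
    A.oracleWinProb ≤ 1 / 2 + 280 * ((A.rest.length : ℝ) + 1) ^ 4 * ε :=
  A.oracleWinProb_le (𝒱 := fun _ => {W | W ∈ QUnitary (S.DReg κ ⊕ Fin A.r)}) hε hε1
    (fun _ _ hW => hW) A.guess.2 (fun U _ _ => U.2) (fun U _ _ _ hW => mul_mem U.2 hW)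
    (fun _ _ _ _ _ _ _ _ _ => h _) (fun _ _ _ _ _ _ _ _ _ => h _)

end QSC

end

theorem theorem6p2 (S : QSC) :
    (S.CompSwapBinding → S.CompOracleSwapBinding) ∧
      (S.StatSwapBinding → S.StatOracleSwapBinding) := by
  constructor
  · intro h
    obtain ⟨μ, hμ, h⟩ := h.exists_uniform
    refine ⟨_, hμ.sqrt, fun A ⟨p, hA⟩ => ?_⟩
    have heval : ∀ κ, (p + 1 + (1 + 7 * ((p + 1) * p + 1 + (p + 1) * p))).eval κ =
        p.eval κ + 1 + (1 + 7 * ((p.eval κ + 1) * p.eval κ + 1 +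
          (p.eval κ + 1) * p.eval κ)) := fun κ => by
      simp
    filter_upwards [h (p + 1 + (1 + 7 * ((p + 1) * p + 1 + (p + 1) * p)))
      (fun κ => (A κ).toAdversary)
      (fun κ => (hA κ).1.mono (by rw [heval]; omega)), hμ.eventually_le_sqrt p] with κ h1 h2
    rw [heval] at h1
    have h3 := QSC.OracleAdversary.oracleWinProb_le_of_size (hμ.1 κ).1 (hμ.1 κ).2 (hA κ) h1
    have h4 := h2 _ (hA κ).2.1
    linarith
  · rintro ⟨μ, hμ, h⟩
    refine ⟨_, hμ.sqrt, fun A ⟨p, hA⟩ => ?_⟩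
    filter_upwards [hμ.eventually_le_sqrt p] with κ h2
    have h3 := (A κ).oracleWinProb_le_of_forall (hμ.1 κ).1 (hμ.1 κ).2
      fun A' => by
        -- The hypothesis speaks of families, so the single adversary `A'` is placed at index κ of
        -- an existing family.
        simpa using h (Function.update (fun κ => (A κ).toAdversary) κ A') κ
    have h4 := h2 _ (hA κ)
    linarith
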